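/- Let $q>2$, $0<h<1$ with $2/h\notin\mathbb N$, $\ell^*:=\lceil 2/h\rceil$, and let $K,L\ge 3\ell^*$. Let $\Lambda=(V,E)$ be the $K\times L$ grid with periodic boundary conditions (the discrete torus), $\mathcal X=\{1,\dots,q\}^V$, and $$H(\sigma)=-\sum_{\{v,w\}\in E}\mathbb 1_{\{\sigma(v)=\sigma(w)\}}-h\sum_{u\in V}\mathbb 1_{\{\sigma(u)=1\}},\qquad \sigma\in\mathcal X .$$ A path is a finite sequence of configurations in which consecutive ones differ at exactly one vertex. For $\sigma\in\mathcal X$ and non-empty $\mathcal A\subseteq\mathcal X$ let $\Phi(\sigma,\mathcal A)$ be the minimum, over all paths from $\sigma$ to an element of $\mathcal A$, of the maximum of $H$ along the path, and let $\Gamma(\sigma,\mathcal A)=\Phi(\sigma,\mathcal A)-H(\sigma)$. The stability level of $\sigma$ is $V_\sigma=\Gamma(\sigma,\{\eta: H(\eta)<H(\sigma)\})$, with $V_\sigma=\infty$ if no $\eta$ has $H(\eta)<H(\sigma)$. Let $\mathcal X^s$ be the set of global minima of $H$ and $\mathcal X^m=\{\eta\in\mathcal X: V_\eta=\max_{\sigma\in\mathcal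 X\setminus\mathcal X^s}V_\sigma\}$ the set of metastable states. Write $\mathbf m$ for the configuration with all spins equal to $m$. Then $\mathcal X^s=\{\mathbf 1\}$, $\mathcal X^m=\{\mathbf 2,\dots,\mathbf q\}$, and for every $\mathbf m\in\mathcal X^m$ $$V_{\mathbf m}=\Gamma(\mathbf m,\mathcal X^s)=4\ell^*-h\bigl(\ell^*(\ell^*-1)+1\bigr).$$ -/

import Mathlib

noncomputable section

/-! ### Energy landscapes `(X, H, Q)` -/

/-- A path of configurations `ω 0, …, ω n` from `σ` to `σ'`: every step is allowed by the
connectivity matrix `Q`. -/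
structure LandscapePath {X : Type*} (Q : X → X → ℝ) (σ σ' : X) where
  n : ℕ
  ω : Fin (n + 1) → X
  start : ω 0 = σ
  finish : ω (Fin.last n) = σ'
  step : ∀ i : Fin n, 0 < Q (ω i.castSucc) (ω i.succ)

/-- The height of a path: the maximum of the energy along it. -/
def LandscapePath.height {X : Type*} {Q : X → X → ℝ} {σ σ' : X} (H : X → ℝ)
    (p : LandscapePath Q σ σ') : ℝ :=
  Finset.univ.sup' Finset.univ_nonempty fun i => H (p.ω i)

/-- The communication height `Φ(σ, σ')`, the minimum of the heights of the paths from `σ` to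
`σ'`; it is `⊤` if there is no path. -/
def commHeight {X : Type*} (H : X → ℝ) (Q : X → X → ℝ) (σ σ' : X) : EReal :=
  ⨅ p : LandscapePath Q σ σ', (p.height H : EReal)

/-- The communication height `Φ(σ, A)` between a configuration and a set; it is `⊤` for `A = ∅`. -/
def commHeightSet {X : Type*} (H : X → ℝ) (Q : X → X → ℝ) (σ : X) (A : Set X) : EReal :=
  ⨅ σ' ∈ A, commHeight H Q σ σ'

/-- `Γ(σ, A) = Φ(σ, A) - H(σ)`. -/
def energyBarrier {X : Type*} (H : X → ℝ) (Q : X → X → ℝ) (σ : X) (A : Set X) : EReal :=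
  commHeightSet H Q σ A - (H σ : EReal)

/-- The stability level `V_σ = Φ(σ, I_σ) - H(σ)`, where `I_σ` is the set of configurations of
energy strictly smaller than `H σ`; it is `⊤` if `I_σ` is empty. -/
def stabilityLevel {X : Type*} (H : X → ℝ) (Q : X → X → ℝ) (σ : X) : EReal :=
  energyBarrier H Q σ {η | H η < H σ}

/-- The stable states: the global minima of the energy. -/
def stableSet {X : Type*} (H : X → ℝ) : Set X :=
  {η | ∀ σ, H η ≤ H σ}

/-- The largest stability level of a configuration that is not stable. -/
def maxStabilityLevel {X : Type*} (H : X → ℝ) (Q : X → X → ℝ) : EReal :=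
  ⨆ σ ∈ (stableSet H)ᶜ, stabilityLevel H Q σ

/-- The metastable states: those whose stability level is the maximum of the stability levels
of the configurations that are not stable. -/
def metastableSet {X : Type*} (H : X → ℝ) (Q : X → X → ℝ) : Set X :=
  {η | stabilityLevel H Q η = maxStabilityLevel H Q}

/-! ### The Potts model on the torus -/

/-- The `K × L` grid with periodic boundary conditions. -/
abbrev torusGraph (K L : ℕ) : SimpleGraph (Fin K × Fin L) :=
  (SimpleGraph.cycleGraph K).boxProd (SimpleGraph.cycleGraph L)

/-- The spin values `{1, …, q}`. -/
abbrev PottsSpin (q : ℕ) : Type := Finset.Icc 1 q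

/-- The spin configurations. -/
abbrev PottsConfig (q K L : ℕ) : Type := Fin K × Fin L → PottsSpin q

open Classical in
/-- The Hamiltonian with coupling constant `1` and external field `h` acting on the spin `1`. An
edge `e` contributes when its two endpoints carry the same spin. -/
def pottsH (q K L : ℕ) (h : ℝ) (σ : PottsConfig q K L) : ℝ :=
  -(∑ e ∈ (torusGraph K L).edgeFinset, if (e.map σ).IsDiag then 1 else 0)
    - h * ∑ u : Fin K × Fin L, if (σ u : ℕ) = 1 then 1 else 0

/-- The connectivity matrix of the single-spin-update dynamics. -/
def pottsQ (q K L : ℕ) (σ σ' : PottsConfig q K L) : ℝ :=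
  if (Finset.univ.filter fun v => σ v ≠ σ' v).card = 1
    then 1 / ((q : ℝ) * (Fintype.card (Fin K × Fin L) : ℝ)) else 0

/-- The configuration in which every vertex has spin `m`. -/
def constConfig {q : ℕ} (K L : ℕ) (m : PottsSpin q) : PottsConfig q K L := fun _ => m

/-- The critical length `⌈2 / h⌉`. -/
def criticalLength (h : ℝ) : ℕ := ⌈2 / h⌉₊

end

/-!
Write `A` for the set of vertices carrying the spin `1`, `∂S` for the edge boundary of a set `S` of
vertices, `ℓ = ⌈2 / h⌉` and `Γ = 4 ℓ - h (ℓ (ℓ - 1) + 1)`. Up to an additive constant the energy is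
the number of edges with different spins minus `h |A|`, and a droplet `S` of spins `1` in a sea of
another single spin has relative energy `E(S) = |∂S| - h |S|`.

*Lower bound for the barrier.* Edges between `A` and its complement have different spins, so the
energy relative to that of a constant configuration with spin `m ≠ 1` is at least `E(A)`. A set
without full rows or columns has at least the perimeter of the rectangle spanned by its two
projections, and a small set containing a full row or column has a large perimeter because the
torus is wide. Hence `E(S) ≥ 0` as long as `|S| ≤ ℓ (ℓ - 1) + 1`, and `E(S) ≥ Γ` in the case of
equality (`dropletEnergy_nonneg`, `le_dropletEnergy_of_card_eq`). Along a path `|A|` changes by at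
most one per step, so a path from a constant configuration to lower energy meets the critical
size.

*Upper bound for all stability levels.* The key is a submodularity inequality
(`pottsH_fill_le`): replacing the spins of an arbitrary configuration `σ` on `D` by `1` costs at
most `E(D) - E(D ∩ A)`. Let `D` grow through squares and quasi-squares, cell by cell, from the
empty set to a square of side `2 ℓ`. For `S ⊆ D` the energy `E(S)` is bounded below by the
energy of a smaller rectangle, which is affine in each side and thus controlled by its corner
values; therefore the cost never exceeds `Γ` and finally is negative
(`dropletEnergy_growingRect_sub_le`, `dropletEnergy_rect_lt`). So every configuration other than
the one of all spins `1` has stability level at most `Γ`, and iterating the descent reaches the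
stable state at the same height.

*Strictness.* The cost `Γ` can be attained only when the first cell is attached to a critical
quasi-square. If `σ` is not constant, the droplet is grown around an edge with different spins:
either both spins differ from `1`, and the submodularity inequality is strict, or `A` meets the
quasi-square, and `E(D ∩ A) > 0` (`pottsH_fill_critical_lt`). Hence exactly the constant
configurations with spin `m ≠ 1` have stability level `Γ`.
-/

open Finset

/-! ### Edge boundaries of finite sets in the torus -/

/-- The number of edges `{x, x + 1}` of the cycle `Fin K` that separate `X` from its complement. -/
def cyclicCuts {K : ℕ} [NeZero K] (X : Finset (Fin K)) : ℕ :=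
  #{x | ¬(x ∈ X ↔ x + 1 ∈ X)}

/-- The part of a set of vertices lying on the horizontal cycle with second coordinate `y`. -/
def rowSlice {K L : ℕ} (S : Finset (Fin K × Fin L)) (y : Fin L) : Finset (Fin K) :=
  {x | (x, y) ∈ S}

/-- The part of a set of vertices lying on the vertical cycle with first coordinate `x`. -/
def colSlice {K L : ℕ} (S : Finset (Fin K × Fin L)) (x : Fin K) : Finset (Fin L) :=
  {y | (x, y) ∈ S}

/-- The size of the edge boundary of a set of vertices of the torus, counted along the horizontal
and the vertical cycles separately. -/
def perimeter {K L : ℕ} [NeZero K] [NeZero L] (S : Finset (Fin K × Fin L)) : ℕ :=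
  ∑ y, cyclicCuts (rowSlice S y) + ∑ x, cyclicCuts (colSlice S x)

@[simp] lemma mem_rowSlice {K L : ℕ} {S : Finset (Fin K × Fin L)} {x : Fin K} {y : Fin L} :
    x ∈ rowSlice S y ↔ (x, y) ∈ S := by simp [rowSlice]

@[simp] lemma mem_colSlice {K L : ℕ} {S : Finset (Fin K × Fin L)} {x : Fin K} {y : Fin L} :
    y ∈ colSlice S x ↔ (x, y) ∈ S := by simp [colSlice]

lemma Fin.val_add_one_eq_ite {K : ℕ} [NeZero K] (x : Fin K) :
    (x + 1).val = if x.val + 1 = K then 0 else x.val + 1 := by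
  have hx := x.isLt
  rw [Fin.val_add, Fin.val_one', Nat.add_mod_mod]
  split_ifs with h
  · rw [h, Nat.mod_self]
  · exact Nat.mod_eq_of_lt (by omega)

/-- A property preserved by the rotation of a cycle holds everywhere once it holds somewhere. -/
lemma Fin.forall_of_forall_add_one {K : ℕ} [NeZero K] {p : Fin K → Prop}
    (hp : ∀ x, p x → p (x + 1)) {x₀ : Fin K} (h₀ : p x₀) (x : Fin K) : p x := by
  have key : ∀ n : ℕ, p (x₀ + Fin.ofNat K n) := by
    intro n
    induction n with
    | zero =>
      have h : Fin.ofNat K 0 = 0 := by ext; simp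
      rw [h, add_zero]; exact h₀
    | succ n ih =>
      have h : Fin.ofNat K (n + 1) = Fin.ofNat K n + 1 := by
        ext; simp [Fin.val_add]
      rw [h, ← add_assoc]
      exact hp _ ih
  have h := key (x - x₀).val
  rwa [Fin.ofNat_val_eq_self, add_sub_cancel] at h

/-- A proper nonempty subset of a cycle is entered and left at least once. -/
lemma two_le_cyclicCuts {K : ℕ} [NeZero K] {X : Finset (Fin K)} (hne : X.Nonempty)
    (hX : X ≠ univ) : 2 ≤ cyclicCuts X := by
  obtain ⟨a, ha⟩ := hne
  obtain ⟨b, hb⟩ : ∃ b, b ∉ X := by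
    by_contra! h
    exact hX (by ext; simp [h])
  obtain ⟨i, hi, hi'⟩ : ∃ i, i ∈ X ∧ i + 1 ∉ X := by
    by_contra! h
    exact hb (Fin.forall_of_forall_add_one h ha b)
  obtain ⟨j, hj, hj'⟩ : ∃ j, j ∉ X ∧ j + 1 ∈ X := by
    by_contra! h
    exact Fin.forall_of_forall_add_one (p := fun x => x ∉ X) h hb a ha
  have hij : i ≠ j := by rintro rfl; exact hj hi
  rw [cyclicCuts, ← Finset.card_pair hij]
  apply Finset.card_le_card
  intro x hx
  rcases Finset.mem_insert.1 hx with rfl | hx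
  · simp [hi, hi']
  · rw [Finset.mem_singleton] at hx
    subst hx
    simp [hj, hj']

lemma cyclicCuts_empty {K : ℕ} [NeZero K] : cyclicCuts (∅ : Finset (Fin K)) = 0 := by
  simp [cyclicCuts]

/-- The arc of `n` consecutive points of a cycle starting at `u`. -/
def arc {K : ℕ} [NeZero K] (u : Fin K) (n : ℕ) : Finset (Fin K) := {x | (x - u).val < n}

@[simp] lemma mem_arc {K : ℕ} [NeZero K] {u x : Fin K} {n : ℕ} :
    x ∈ arc u n ↔ (x - u).val < n := by simp [arc]

lemma arc_mono {K : ℕ} [NeZero K] (u : Fin K) {m n : ℕ} (h : m ≤ n) : arc u m ⊆ arc u n := by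
  intro x hx
  rw [mem_arc] at hx ⊢
  omega

@[simp] lemma arc_zero {K : ℕ} [NeZero K] (u : Fin K) : arc u 0 = ∅ := by
  ext; simp

lemma card_arc {K : ℕ} [NeZero K] (u : Fin K) {n : ℕ} (h : n ≤ K) : #(arc u n) = n := by
  have h1 : #(arc u n) = #{i : Fin K | i.val < n} := by
    apply Finset.card_bij (fun x _ => x - u)
    · intro x hx; simpa using hx
    · intro x _ y _ hxy; exact sub_left_injective hxy
    · intro y hy; exact ⟨y + u, by simpa using hy, by simp⟩
  rw [h1, Fin.card_filter_val_lt, min_eq_right h]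

lemma cyclicCuts_arc_le {K : ℕ} [NeZero K] (u : Fin K) (n : ℕ) : cyclicCuts (arc u n) ≤ 2 := by
  have hsub : (univ.filter fun x => ¬(x ∈ arc u n ↔ x + 1 ∈ arc u n)) ⊆
      {u + Fin.ofNat K (n - 1), u + Fin.ofNat K (K - 1)} := by
    intro x hx
    simp only [mem_filter, mem_univ, true_and, mem_arc] at hx
    have h1 : x + 1 - u = (x - u) + 1 := by abel
    rw [h1, Fin.val_add_one_eq_ite] at hx
    have hlt := (x - u).isLt
    have hval : (x - u).val = n - 1 ∨ (x - u).val = K - 1 := by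
      split_ifs at hx <;> omega
    rw [mem_insert, mem_singleton]
    have hx' : x = u + Fin.ofNat K (x - u).val := by simp
    rcases hval with h | h
    · left; rw [← h]; exact hx'
    · right; rw [← h]; exact hx'
  exact (Finset.card_le_card hsub).trans Finset.card_le_two

/-- The set of vertices with both coordinates exchanged. -/
def transpose {K L : ℕ} (S : Finset (Fin K × Fin L)) : Finset (Fin L × Fin K) :=
  S.map (Equiv.prodComm _ _).toEmbedding

@[simp] lemma mem_transpose {K L : ℕ} {S : Finset (Fin K × Fin L)} {x : Fin L} {y : Fin K} :
    (x, y) ∈ transpose S ↔ (y, x) ∈ S := by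
  simp [transpose]

lemma card_transpose {K L : ℕ} (S : Finset (Fin K × Fin L)) : #(transpose S) = #S :=
  Finset.card_map _

lemma perimeter_transpose {K L : ℕ} [NeZero K] [NeZero L] (S : Finset (Fin K × Fin L)) :
    perimeter (transpose S) = perimeter S := by
  have h1 : ∀ y, rowSlice (transpose S) y = colSlice S y := by intro y; ext; simp
  have h2 : ∀ y, colSlice (transpose S) y = rowSlice S y := by intro y; ext; simp
  simp only [perimeter, h1, h2]
  exact add_comm _ _

lemma transpose_subset {K L : ℕ} {S T : Finset (Fin K × Fin L)} (h : S ⊆ T) :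
    transpose S ⊆ transpose T := Finset.map_subset_map.2 h

/-- Every nonempty slice of a set without full slices contributes two boundary edges. -/
lemma two_mul_projections_le_perimeter {K L : ℕ} [NeZero K] [NeZero L]
    {S : Finset (Fin K × Fin L)} (hrow : ∀ y, rowSlice S y ≠ univ)
    (hcol : ∀ x, colSlice S x ≠ univ) :
    2 * (#(S.image Prod.fst) + #(S.image Prod.snd)) ≤ perimeter S := by
  have h1 : 2 * #(S.image Prod.snd) ≤ ∑ y, cyclicCuts (rowSlice S y) := by
    rw [mul_comm, ← smul_eq_mul]
    refine (Finset.card_nsmul_le_sum _ _ _ ?_).trans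
      (Finset.sum_le_sum_of_subset (Finset.subset_univ _))
    intro y hy
    obtain ⟨⟨x, y'⟩, hv, rfl⟩ := Finset.mem_image.1 hy
    exact two_le_cyclicCuts ⟨x, by simpa using hv⟩ (hrow _)
  have h2 : 2 * #(S.image Prod.fst) ≤ ∑ x, cyclicCuts (colSlice S x) := by
    rw [mul_comm, ← smul_eq_mul]
    refine (Finset.card_nsmul_le_sum _ _ _ ?_).trans
      (Finset.sum_le_sum_of_subset (Finset.subset_univ _))
    intro x hx
    obtain ⟨⟨x', y⟩, hv, rfl⟩ := Finset.mem_image.1 hx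
    exact two_le_cyclicCuts ⟨y, by simpa using hv⟩ (hcol _)
  unfold perimeter
  omega

lemma card_le_card_image_fst_mul_card_image_snd {K L : ℕ} (S : Finset (Fin K × Fin L)) :
    #S ≤ #(S.image Prod.fst) * #(S.image Prod.snd) := by
  rw [← Finset.card_product]
  exact Finset.card_le_card Finset.subset_product

/-- If a horizontal cycle lies in `S`, then every vertical cycle meets `S`, and few of them can be
contained in `S` when `S` is small. -/
lemma four_mul_le_perimeter_of_rowSlice_eq_univ {K L ℓ : ℕ} [NeZero K] [NeZero L]
    (hK : 3 * ℓ ≤ K) (hL : 3 * ℓ ≤ L) {S : Finset (Fin K × Fin L)} (hS : #S ≤ ℓ * ℓ)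
    (y : Fin L) (hy : rowSlice S y = univ) : 4 * ℓ ≤ perimeter S := by
  set F : Finset (Fin K) := {x | colSlice S x = univ} with hF
  have hFL : #F * L ≤ #S := by
    have hsub : F ×ˢ (univ : Finset (Fin L)) ⊆ S := by
      rintro ⟨x, y⟩ hv
      have hx : colSlice S x = univ := by simpa [hF] using hv
      rw [← mem_colSlice, hx]
      exact mem_univ _
    simpa using Finset.card_le_card hsub
  have hFle : #F ≤ ℓ := by
    by_contra! hlt
    have : (ℓ + 1) * (3 * ℓ) ≤ #F * L := Nat.mul_le_mul hlt hL
    have : #F * 1 ≤ #F * L := Nat.mul_le_mul_left _ (NeZero.pos L)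
    nlinarith
  have hcard : #F + #Fᶜ = K := by simp
  have hsum : #Fᶜ * 2 ≤ ∑ x, cyclicCuts (colSlice S x) := by
    rw [← smul_eq_mul]
    refine (Finset.card_nsmul_le_sum _ _ _ ?_).trans
      (Finset.sum_le_sum_of_subset (Finset.subset_univ _))
    intro x hx
    have hx' : colSlice S x ≠ univ := by simpa [hF] using hx
    refine two_le_cyclicCuts ⟨y, ?_⟩ hx'
    rw [mem_colSlice, ← mem_rowSlice, hy]
    exact mem_univ _
  unfold perimeter
  omega

/-- Isoperimetry in the torus for small sets: the perimeter is at least that of an enclosing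
rectangle, unless it is large because the set wraps around the torus. -/
lemma perimeter_lower_bound {K L ℓ : ℕ} [NeZero K] [NeZero L] (hK : 3 * ℓ ≤ K)
    (hL : 3 * ℓ ≤ L) {S : Finset (Fin K × Fin L)} (hS : #S ≤ ℓ * ℓ) :
    4 * ℓ ≤ perimeter S ∨ ∃ a b : ℕ, #S ≤ a * b ∧ 2 * (a + b) ≤ perimeter S := by
  by_cases hrow : ∃ y, rowSlice S y = univ
  · obtain ⟨y, hy⟩ := hrow
    exact Or.inl (four_mul_le_perimeter_of_rowSlice_eq_univ hK hL hS y hy)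
  by_cases hcol : ∃ x, colSlice S x = univ
  · obtain ⟨x, hx⟩ := hcol
    left
    rw [← perimeter_transpose]
    refine four_mul_le_perimeter_of_rowSlice_eq_univ hL hK (by rwa [card_transpose]) x ?_
    rw [← hx]
    ext
    simp
  push Not at hrow hcol
  exact Or.inr ⟨_, _, card_le_card_image_fst_mul_card_image_snd S,
    two_mul_projections_le_perimeter hrow hcol⟩

/-! ### The Hamiltonian in terms of boundaries -/

lemma Fin.add_one_ne_self {K : ℕ} [NeZero K] (hK : 3 ≤ K) (x : Fin K) : x + 1 ≠ x := by
  intro h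
  have h1 := congrArg Fin.val h
  rw [Fin.val_add_one_eq_ite] at h1
  split_ifs at h1 <;> omega

lemma Fin.add_one_add_one_ne_self {K : ℕ} [NeZero K] (hK : 3 ≤ K) (x : Fin K) :
    x + 1 + 1 ≠ x := by
  intro h
  have h1 := congrArg Fin.val h
  rw [Fin.val_add_one_eq_ite, Fin.val_add_one_eq_ite] at h1
  split_ifs at h1 <;> omega

lemma cycleGraph_adj_iff {K : ℕ} [NeZero K] (hK : 3 ≤ K) {x y : Fin K} :
    (SimpleGraph.cycleGraph K).Adj x y ↔ y = x + 1 ∨ x = y + 1 := by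
  obtain ⟨k, rfl⟩ : ∃ k, K = k + 2 := ⟨K - 2, by omega⟩
  rw [SimpleGraph.cycleGraph_adj, sub_eq_iff_eq_add', sub_eq_iff_eq_add', or_comm]

/-- Each edge of the torus is `{v, v + e₁}` or `{v, v + e₂}` for exactly one vertex `v`. -/
lemma sum_edgeFinset_torusGraph {K L : ℕ} [NeZero K] [NeZero L] (hK : 3 ≤ K) (hL : 3 ≤ L)
    {_ : Fintype (torusGraph K L).edgeSet} (f : Sym2 (Fin K × Fin L) → ℝ) :
    ∑ e ∈ (torusGraph K L).edgeFinset, f e =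
      ∑ v : Fin K × Fin L, f s(v, (v.1 + 1, v.2)) +
        ∑ v : Fin K × Fin L, f s(v, (v.1, v.2 + 1)) := by
  classical
  let g : (Fin K × Fin L) ⊕ (Fin K × Fin L) → Sym2 (Fin K × Fin L) :=
    Sum.elim (fun v => s(v, (v.1 + 1, v.2))) (fun v => s(v, (v.1, v.2 + 1)))
  have hg : Function.Injective g := by
    rintro (⟨x, y⟩ | ⟨x, y⟩) (⟨x', y'⟩ | ⟨x', y'⟩) h <;>
      simp only [g, Sum.elim_inl, Sum.elim_inr, Sym2.eq_iff, Prod.mk.injEq] at h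
    · rcases h with ⟨⟨rfl, rfl⟩, -⟩ | ⟨⟨rfl, -⟩, h, -⟩
      · rfl
      · exact absurd h (Fin.add_one_add_one_ne_self hK _)
    · rcases h with ⟨⟨rfl, -⟩, h, -⟩ | ⟨⟨rfl, -⟩, h, -⟩ <;>
        exact absurd h (Fin.add_one_ne_self hK _)
    · rcases h with ⟨⟨-, rfl⟩, -, h⟩ | ⟨⟨-, rfl⟩, -, h⟩
      · exact absurd h (Fin.add_one_ne_self hL _)
      · exact absurd h (Fin.add_one_ne_self hL _)
    · rcases h with ⟨⟨rfl, rfl⟩, -⟩ | ⟨⟨-, hy⟩, -, h⟩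
      · rfl
      · exact absurd (hy ▸ h) (Fin.add_one_add_one_ne_self hL y')
  have himg : (torusGraph K L).edgeFinset = univ.image g := by
    ext e
    induction e with | _ v w => ?_
    obtain ⟨x, y⟩ := v
    obtain ⟨x', y'⟩ := w
    simp only [SimpleGraph.mem_edgeFinset, SimpleGraph.mem_edgeSet, SimpleGraph.boxProd_adj,
      cycleGraph_adj_iff hK, cycleGraph_adj_iff hL, mem_image, mem_univ, true_and, Sum.exists, g,
      Sum.elim_inl, Sum.elim_inr, Sym2.eq_iff, Prod.exists, Prod.mk.injEq]
    constructor
    · rintro (⟨rfl | rfl, rfl⟩ | ⟨rfl | rfl, rfl⟩)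
      · exact Or.inl ⟨_, _, Or.inl ⟨⟨rfl, rfl⟩, rfl, rfl⟩⟩
      · exact Or.inl ⟨_, _, Or.inr ⟨⟨rfl, rfl⟩, rfl, rfl⟩⟩
      · exact Or.inr ⟨_, _, Or.inl ⟨⟨rfl, rfl⟩, rfl, rfl⟩⟩
      · exact Or.inr ⟨_, _, Or.inr ⟨⟨rfl, rfl⟩, rfl, rfl⟩⟩
    · rintro (⟨a, b, h⟩ | ⟨a, b, h⟩) <;>
        rcases h with ⟨⟨rfl, rfl⟩, rfl, rfl⟩ | ⟨⟨rfl, rfl⟩, rfl, rfl⟩ <;> simp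
  rw [himg, Finset.sum_image (fun _ _ _ _ h => hg h), Fintype.sum_sum_type]
  rfl

/-- `1` if the two spins differ and `0` otherwise. -/
def disagree {q : ℕ} (a b : PottsSpin q) : ℝ := if a = b then 0 else 1

/-- The number of edges whose endpoints carry different spins. -/
def interfaceLength {q K L : ℕ} [NeZero K] [NeZero L] (σ : PottsConfig q K L) : ℝ :=
  ∑ v : Fin K × Fin L, disagree (σ v) (σ (v.1 + 1, v.2)) +
    ∑ v : Fin K × Fin L, disagree (σ v) (σ (v.1, v.2 + 1))

/-- The set of vertices carrying the spin `1`. -/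
def onesSet {q K L : ℕ} (σ : PottsConfig q K L) : Finset (Fin K × Fin L) := {v | (σ v : ℕ) = 1}

@[simp] lemma mem_onesSet {q K L : ℕ} {σ : PottsConfig q K L} {v : Fin K × Fin L} :
    v ∈ onesSet σ ↔ (σ v : ℕ) = 1 := by simp [onesSet]

lemma disagree_nonneg {q : ℕ} (a b : PottsSpin q) : 0 ≤ disagree a b := by
  unfold disagree
  split_ifs <;> norm_num

lemma interfaceLength_nonneg {q K L : ℕ} [NeZero K] [NeZero L] (σ : PottsConfig q K L) :
    0 ≤ interfaceLength σ :=
  add_nonneg (Finset.sum_nonneg fun _ _ => disagree_nonneg _ _)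
    (Finset.sum_nonneg fun _ _ => disagree_nonneg _ _)

lemma pottsH_eq {q K L : ℕ} [NeZero K] [NeZero L] (hK : 3 ≤ K) (hL : 3 ≤ L) (h : ℝ)
    (σ : PottsConfig q K L) :
    pottsH q K L h σ = interfaceLength σ - h * #(onesSet σ) - 2 * (K * L) := by
  have hd : ∀ v w : Fin K × Fin L,
      (1 : ℝ) - disagree (σ v) (σ w) = if σ v = σ w then 1 else 0 := by
    intro v w
    unfold disagree
    split_ifs <;> norm_num
  have hcard : ∑ _v : Fin K × Fin L, (1 : ℝ) = K * L := by simp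
  unfold pottsH interfaceLength
  rw [sum_edgeFinset_torusGraph hK hL]
  simp only [Sym2.map_mk, Sym2.mk_isDiag_iff, ← hd, Finset.sum_sub_distrib, hcard, onesSet,
    Finset.card_filter]
  push_cast
  ring

/-- `1` if exactly one of the two vertices lies in `S` and `0` otherwise. -/
def cutIndicator {V : Type*} [DecidableEq V] (S : Finset V) (v w : V) : ℝ :=
  if v ∈ S ↔ w ∈ S then 0 else 1

lemma perimeter_eq_sum {K L : ℕ} [NeZero K] [NeZero L] (S : Finset (Fin K × Fin L)) :
    (perimeter S : ℝ) = ∑ v : Fin K × Fin L, cutIndicator S v (v.1 + 1, v.2) +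
      ∑ v : Fin K × Fin L, cutIndicator S v (v.1, v.2 + 1) := by
  have h1 : ∀ p : Prop, ∀ [Decidable p], (if p then (0 : ℝ) else 1) = if ¬p then 1 else 0 := by
    intro p _
    split_ifs <;> rfl
  simp only [perimeter, cyclicCuts, mem_rowSlice, mem_colSlice, cutIndicator, h1,
    Finset.card_filter, Fintype.sum_prod_type]
  push_cast
  rw [Finset.sum_comm]

/-- The energy of a droplet `S` of spins `1` in a sea of another single spin, relative to that
sea. -/
def dropletEnergy {K L : ℕ} [NeZero K] [NeZero L] (h : ℝ) (S : Finset (Fin K × Fin L)) : ℝ :=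
  perimeter S - h * #S

lemma dropletEnergy_transpose {K L : ℕ} [NeZero K] [NeZero L] (h : ℝ)
    (S : Finset (Fin K × Fin L)) : dropletEnergy h (transpose S) = dropletEnergy h S := by
  simp [dropletEnergy, perimeter_transpose, card_transpose]

lemma cutIndicator_onesSet_le_disagree {q K L : ℕ} (σ : PottsConfig q K L)
    (v w : Fin K × Fin L) : cutIndicator (onesSet σ) v w ≤ disagree (σ v) (σ w) := by
  unfold cutIndicator disagree
  simp only [mem_onesSet]
  split_ifs with h1 h2 h2
  · rfl
  · norm_num
  · exact absurd (by rw [h2]) h1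
  · rfl

lemma dropletEnergy_onesSet_le {q K L : ℕ} [NeZero K] [NeZero L] (hK : 3 ≤ K) (hL : 3 ≤ L)
    (h : ℝ) (σ : PottsConfig q K L) :
    dropletEnergy h (onesSet σ) ≤ pottsH q K L h σ + 2 * (K * L) := by
  have h1 : (perimeter (onesSet σ) : ℝ) ≤ interfaceLength σ := by
    rw [perimeter_eq_sum]
    exact add_le_add (Finset.sum_le_sum fun _ _ => cutIndicator_onesSet_le_disagree _ _ _)
      (Finset.sum_le_sum fun _ _ => cutIndicator_onesSet_le_disagree _ _ _)
  rw [pottsH_eq hK hL, dropletEnergy]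
  linarith

/-- The configuration `σ` with all spins in `D` replaced by the spin `s`. -/
def fill {q K L : ℕ} (s : PottsSpin q) (σ : PottsConfig q K L) (D : Finset (Fin K × Fin L)) :
    PottsConfig q K L := fun v => if v ∈ D then s else σ v

/-- Filling `D` with the spin `1` changes the disagreement across an edge by at most the change
caused by enlarging `D ∩ onesSet σ` to `D`. -/
lemma disagree_fill_add_cutIndicator_le {q K L : ℕ} {s : PottsSpin q} (hs : (s : ℕ) = 1)
    (σ : PottsConfig q K L) (D : Finset (Fin K × Fin L)) (v w : Fin K × Fin L) :
    disagree (fill s σ D v) (fill s σ D w) + cutIndicator (D ∩ onesSet σ) v w ≤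
      disagree (σ v) (σ w) + cutIndicator D v w := by
  have hiff : ∀ v, (σ v : ℕ) = 1 ↔ σ v = s := by
    intro v; rw [Subtype.ext_iff, hs]
  simp only [disagree, fill, cutIndicator, mem_inter, mem_onesSet, hiff]
  by_cases hv : v ∈ D <;> by_cases hw : w ∈ D <;> simp only [hv, hw]
  all_goals
    by_cases h1 : σ v = s <;> by_cases h2 : σ w = s <;> by_cases h3 : σ v = σ w <;>
      simp_all [eq_comm]

lemma disagree_fill_add_cutIndicator_lt {q K L : ℕ} (s : PottsSpin q)
    (σ : PottsConfig q K L) (D : Finset (Fin K × Fin L)) {v w : Fin K × Fin L} (hv : v ∈ D)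
    (hw : w ∈ D) (hv1 : v ∉ onesSet σ) (hw1 : w ∉ onesSet σ) (hvw : σ v ≠ σ w) :
    disagree (fill s σ D v) (fill s σ D w) + cutIndicator (D ∩ onesSet σ) v w <
      disagree (σ v) (σ w) + cutIndicator D v w := by
  rw [mem_onesSet] at hv1 hw1
  simp [disagree, fill, cutIndicator, hv, hw, hv1, hw1, hvw]

lemma card_onesSet_fill {q K L : ℕ} {s : PottsSpin q} (hs : (s : ℕ) = 1)
    (σ : PottsConfig q K L) (D : Finset (Fin K × Fin L)) :
    #(onesSet (fill s σ D)) + #(D ∩ onesSet σ) = #(onesSet σ) + #D := by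
  have h1 : onesSet (fill s σ D) = D ∪ onesSet σ := by
    ext v
    by_cases hv : v ∈ D <;> simp [fill, hv, hs]
  rw [h1, Finset.card_union_add_card_inter, add_comm]

lemma pottsH_fill_sub_eq {q K L : ℕ} [NeZero K] [NeZero L] (hK : 3 ≤ K)
    (hL : 3 ≤ L) (h : ℝ) {s : PottsSpin q} (hs : (s : ℕ) = 1) (σ : PottsConfig q K L)
    (D : Finset (Fin K × Fin L)) :
    (pottsH q K L h (fill s σ D) + dropletEnergy h (D ∩ onesSet σ)) -
        (pottsH q K L h σ + dropletEnergy h D) =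
      (interfaceLength (fill s σ D) + perimeter (D ∩ onesSet σ)) -
        (interfaceLength σ + perimeter D) := by
  have hc : (#(onesSet (fill s σ D)) : ℝ) + #(D ∩ onesSet σ) = #(onesSet σ) + #D := by
    exact_mod_cast card_onesSet_fill hs σ D
  rw [pottsH_eq hK hL, pottsH_eq hK hL, dropletEnergy, dropletEnergy]
  linear_combination (-h) * hc

/-- Submodularity: filling `D` costs at most as much as growing a droplet from `D ∩ onesSet σ` to
`D` in a monochromatic sea. -/
lemma pottsH_fill_le {q K L : ℕ} [NeZero K] [NeZero L] (hK : 3 ≤ K) (hL : 3 ≤ L) (h : ℝ)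
    {s : PottsSpin q} (hs : (s : ℕ) = 1) (σ : PottsConfig q K L) (D : Finset (Fin K × Fin L)) :
    pottsH q K L h (fill s σ D) ≤
      pottsH q K L h σ + (dropletEnergy h D - dropletEnergy h (D ∩ onesSet σ)) := by
  have key := pottsH_fill_sub_eq hK hL h hs σ D
  have h1 : interfaceLength (fill s σ D) + perimeter (D ∩ onesSet σ) ≤
      interfaceLength σ + perimeter D := by
    have e1 := Finset.sum_le_sum fun (v : Fin K × Fin L) (_ : v ∈ univ) =>
      disagree_fill_add_cutIndicator_le hs σ D v (v.1 + 1, v.2)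
    have e2 := Finset.sum_le_sum fun (v : Fin K × Fin L) (_ : v ∈ univ) =>
      disagree_fill_add_cutIndicator_le hs σ D v (v.1, v.2 + 1)
    simp only [Finset.sum_add_distrib] at e1 e2
    rw [perimeter_eq_sum, perimeter_eq_sum, interfaceLength, interfaceLength]
    linarith
  linarith

/-- The submodularity bound is strict if `D` contains an edge whose endpoints carry two different
spins, neither of them `1`. -/
lemma pottsH_fill_lt {q K L : ℕ} [NeZero K] [NeZero L] (hK : 3 ≤ K) (hL : 3 ≤ L) (h : ℝ)
    {s : PottsSpin q} (hs : (s : ℕ) = 1) (σ : PottsConfig q K L) (D : Finset (Fin K × Fin L))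
    {v w : Fin K × Fin L} (hedge : w = (v.1 + 1, v.2) ∨ w = (v.1, v.2 + 1)) (hv : v ∈ D)
    (hw : w ∈ D) (hv1 : v ∉ onesSet σ) (hw1 : w ∉ onesSet σ) (hvw : σ v ≠ σ w) :
    pottsH q K L h (fill s σ D) <
      pottsH q K L h σ + (dropletEnergy h D - dropletEnergy h (D ∩ onesSet σ)) := by
  have key := pottsH_fill_sub_eq hK hL h hs σ D
  have h1 : interfaceLength (fill s σ D) + perimeter (D ∩ onesSet σ) <
      interfaceLength σ + perimeter D := by
    have e1 := Finset.sum_le_sum fun (v : Fin K × Fin L) (_ : v ∈ univ) =>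
      disagree_fill_add_cutIndicator_le hs σ D v (v.1 + 1, v.2)
    have e2 := Finset.sum_le_sum fun (v : Fin K × Fin L) (_ : v ∈ univ) =>
      disagree_fill_add_cutIndicator_le hs σ D v (v.1, v.2 + 1)
    rw [perimeter_eq_sum, perimeter_eq_sum, interfaceLength, interfaceLength]
    rcases hedge with rfl | rfl
    · have e3 := Finset.sum_lt_sum
        (fun (v : Fin K × Fin L) (_ : v ∈ univ) =>
          disagree_fill_add_cutIndicator_le hs σ D v (v.1 + 1, v.2))
        ⟨v, mem_univ _, disagree_fill_add_cutIndicator_lt s σ D hv hw hv1 hw1 hvw⟩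
      simp only [Finset.sum_add_distrib] at e2 e3
      linarith
    · have e3 := Finset.sum_lt_sum
        (fun (v : Fin K × Fin L) (_ : v ∈ univ) =>
          disagree_fill_add_cutIndicator_le hs σ D v (v.1, v.2 + 1))
        ⟨v, mem_univ _, disagree_fill_add_cutIndicator_lt s σ D hv hw hv1 hw1 hvw⟩
      simp only [Finset.sum_add_distrib] at e1 e3
      linarith
  linarith

/-! ### Rectangles and growing rectangles -/

/-- The `a × b` rectangle with lower left corner `u`, together with the first `j` cells of the
column to the right of it. -/
def growingRect {K L : ℕ} [NeZero K] [NeZero L] (u : Fin K × Fin L) (a b j : ℕ) :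
    Finset (Fin K × Fin L) :=
  arc u.1 a ×ˢ arc u.2 b ∪ (arc u.1 (a + 1) \ arc u.1 a) ×ˢ arc u.2 j

section GrowingRect

variable {K L : ℕ} [NeZero K] [NeZero L] {u : Fin K × Fin L} {a b j : ℕ}

lemma mem_growingRect {x : Fin K} {y : Fin L} :
    (x, y) ∈ growingRect u a b j ↔ ((x - u.1).val < a ∧ (y - u.2).val < b) ∨
      ((x - u.1).val = a ∧ (y - u.2).val < j) := by
  simp only [growingRect, mem_union, mem_product, mem_sdiff, mem_arc]
  omega

lemma growingRect_zero : growingRect u a b 0 = arc u.1 a ×ˢ arc u.2 b := by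
  simp [growingRect]

lemma growingRect_self : growingRect u a b b = arc u.1 (a + 1) ×ˢ arc u.2 b := by
  ext ⟨x, y⟩
  rw [mem_growingRect, mem_product, mem_arc, mem_arc]
  dsimp only
  omega

lemma card_growingRect (ha : a + 1 ≤ K) (hb : b ≤ L) (hj : j ≤ b) :
    #(growingRect u a b j) = a * b + j := by
  have hsub := arc_mono u.1 (Nat.le_succ a)
  have hdisj : Disjoint (arc u.1 a ×ˢ arc u.2 b)
      ((arc u.1 (a + 1) \ arc u.1 a) ×ˢ arc u.2 j) := by
    rw [Finset.disjoint_product]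
    exact Or.inl Finset.disjoint_sdiff
  rw [growingRect, Finset.card_union_of_disjoint hdisj, card_product, card_product,
    Finset.card_sdiff_of_subset hsub, card_arc _ ha, card_arc _ (by omega), card_arc _ hb,
    card_arc _ (by omega)]
  simp

lemma perimeter_growingRect_le (ha : a + 1 ≤ K) (hb : b ≤ L) (hj : j ≤ b) :
    perimeter (growingRect u a b j) ≤ 2 * (a + 1 + b) := by
  have hrow : ∀ y, cyclicCuts (rowSlice (growingRect u a b j) y) ≤
      if y ∈ arc u.2 b then 2 else 0 := by
    intro y
    have hslice : rowSlice (growingRect u a b j) y =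
        arc u.1 (if (y - u.2).val < j then a + 1 else if (y - u.2).val < b then a else 0) := by
      ext x
      rw [mem_rowSlice, mem_growingRect, mem_arc]
      split_ifs <;> omega
    rw [hslice]
    by_cases hy : y ∈ arc u.2 b
    · rw [if_pos hy]
      exact cyclicCuts_arc_le _ _
    · rw [if_neg hy]
      rw [mem_arc] at hy
      rw [if_neg (by omega), if_neg hy, arc_zero, cyclicCuts_empty]
  have hcol : ∀ x, cyclicCuts (colSlice (growingRect u a b j) x) ≤
      if x ∈ arc u.1 (a + 1) then 2 else 0 := by
    intro x
    have hslice : colSlice (growingRect u a b j) x =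
        arc u.2 (if (x - u.1).val < a then b else if (x - u.1).val = a then j else 0) := by
      ext y
      rw [mem_colSlice, mem_growingRect, mem_arc]
      split_ifs <;> omega
    rw [hslice]
    by_cases hx : x ∈ arc u.1 (a + 1)
    · rw [if_pos hx]
      exact cyclicCuts_arc_le _ _
    · rw [if_neg hx]
      rw [mem_arc] at hx
      rw [if_neg (by omega), if_neg (by omega), arc_zero, cyclicCuts_empty]
  have h1 := Finset.sum_le_sum fun y (_ : y ∈ univ) => hrow y
  have h2 := Finset.sum_le_sum fun x (_ : x ∈ univ) => hcol x
  rw [← Finset.sum_filter, Finset.filter_mem_eq_inter, Finset.univ_inter, Finset.sum_const,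
    smul_eq_mul, card_arc _ hb] at h1
  rw [← Finset.sum_filter, Finset.filter_mem_eq_inter, Finset.univ_inter, Finset.sum_const,
    smul_eq_mul, card_arc _ ha] at h2
  unfold perimeter
  omega

/-- A subset of a growing rectangle is measured by the projections `p`, `r` of its part in the
rectangle and by the number `i` of its remaining cells, which widen it by one column. -/
lemma exists_dimensions_of_subset_growingRect (ha : a + 1 < K) (hb : b < L) (hj : j ≤ b)
    {S : Finset (Fin K × Fin L)} (hS : S ⊆ growingRect u a b j) :
    ∃ p r i : ℕ, p ≤ a ∧ r ≤ b ∧ i ≤ j ∧ #S ≤ p * r + i ∧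
      2 * (p + r + if i = 0 then 0 else 1) ≤ perimeter S ∧
      ((S ∩ arc u.1 a ×ˢ arc u.2 b).Nonempty → 1 ≤ p ∧ 1 ≤ r) := by
  set R := arc u.1 a ×ˢ arc u.2 b with hR
  have hrow : ∀ y, rowSlice S y ≠ univ := by
    intro y hy
    have hsub : (univ : Finset (Fin K)) ⊆ arc u.1 (a + 1) := by
      rw [← hy]
      intro x hx
      have := mem_growingRect.1 (hS (mem_rowSlice.1 hx))
      rw [mem_arc]
      omega
    have := Finset.card_le_card hsub
    rw [card_arc _ ha.le, Finset.card_univ, Fintype.card_fin] at this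
    omega
  have hcol : ∀ x, colSlice S x ≠ univ := by
    intro x hx
    have hsub : (univ : Finset (Fin L)) ⊆ arc u.2 b := by
      rw [← hx]
      intro y hy
      have := mem_growingRect.1 (hS (mem_colSlice.1 hy))
      rw [mem_arc]
      omega
    have := Finset.card_le_card hsub
    rw [card_arc _ hb.le, Finset.card_univ, Fintype.card_fin] at this
    omega
  have hper := two_mul_projections_le_perimeter hrow hcol
  have hi : #(S \ R) ≤ j := by
    have hsub : S \ R ⊆ (arc u.1 (a + 1) \ arc u.1 a) ×ˢ arc u.2 j := by
      intro v hv
      rw [mem_sdiff] at hv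
      exact (mem_union.1 (hS hv.1)).resolve_left hv.2
    have := Finset.card_le_card hsub
    rw [card_product, Finset.card_sdiff_of_subset (arc_mono u.1 (Nat.le_succ a)),
      card_arc _ ha.le, card_arc _ (by omega), card_arc _ (by omega)] at this
    simpa using this
  have hfst : (S ∩ R).image Prod.fst ⊆ arc u.1 a := by
    intro x hx
    obtain ⟨v, hv, rfl⟩ := mem_image.1 hx
    exact (mem_product.1 (mem_inter.1 hv).2).1
  have hsnd : (S ∩ R).image Prod.snd ⊆ arc u.2 b := by
    intro x hx
    obtain ⟨v, hv, rfl⟩ := mem_image.1 hx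
    exact (mem_product.1 (mem_inter.1 hv).2).2
  have hp := Finset.card_le_card hfst
  have hr := Finset.card_le_card hsnd
  rw [card_arc _ (by omega)] at hp hr
  have hr' : #((S ∩ R).image Prod.snd) ≤ #(S.image Prod.snd) :=
    Finset.card_le_card (Finset.image_subset_image Finset.inter_subset_left)
  have hp' : #((S ∩ R).image Prod.fst) + (if #(S \ R) = 0 then 0 else 1) ≤
      #(S.image Prod.fst) := by
    split_ifs with h0
    · exact Finset.card_le_card (Finset.image_subset_image Finset.inter_subset_left)
    · obtain ⟨v, hv⟩ := Finset.card_ne_zero.1 h0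
      rw [mem_sdiff] at hv
      refine Finset.card_lt_card ((Finset.ssubset_iff_of_subset
        (Finset.image_subset_image Finset.inter_subset_left)).2
          ⟨v.1, mem_image_of_mem _ hv.1, fun hmem => ?_⟩)
      have h1 := (mem_union.1 (hS hv.1)).resolve_left hv.2
      exact (mem_sdiff.1 (mem_product.1 h1).1).2 (hfst hmem)
  refine ⟨_, _, _, hp, hr, hi, ?_, ?_, ?_⟩
  · rw [← Finset.card_inter_add_card_sdiff S R]
    exact Nat.add_le_add_right (card_le_card_image_fst_mul_card_image_snd _) _
  · omega
  · intro hne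
    exact ⟨Finset.card_pos.2 (hne.image _), Finset.card_pos.2 (hne.image _)⟩

end GrowingRect

/-- The energy of an `a × b` rectangle of spins `1` in a sea of another single spin. -/
def rectEnergy (h a b : ℝ) : ℝ := 2 * (a + b) - h * (a * b)

/-- The rectangle energy is affine in each side, so its minimum over all smaller rectangles is
attained at a corner of the range of sides. -/
lemma min_zero_rectEnergy_le {h a b p r : ℝ} (hp : 0 ≤ p) (hpa : p ≤ a) (hr : 0 ≤ r)
    (hrb : r ≤ b) : min 0 (rectEnergy h a b) ≤ rectEnergy h p r := by
  unfold rectEnergy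
  rcases le_total (h * r) 2 with h1 | h1
  · refine (min_le_left _ _).trans ?_
    nlinarith [mul_nonneg hp (sub_nonneg.2 h1)]
  rcases le_total (h * a) 2 with h2 | h2
  · refine (min_le_left _ _).trans ?_
    nlinarith [mul_nonneg (sub_nonneg.2 hpa) (sub_nonneg.2 h1), mul_nonneg hr (sub_nonneg.2 h2)]
  · refine (min_le_right _ _).trans ?_
    nlinarith [mul_nonneg (sub_nonneg.2 hpa) (sub_nonneg.2 h1),
      mul_nonneg (sub_nonneg.2 hrb) (sub_nonneg.2 h2)]

lemma rectEnergy_lt {h a b p r : ℝ} (hp : 0 ≤ p) (hpa : p ≤ a) (hr : 0 ≤ r)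
    (hrb : r ≤ b) (hneg : rectEnergy h a b < 0) (hne : p ≠ a ∨ r ≠ b) :
    rectEnergy h a b < rectEnergy h p r := by
  unfold rectEnergy at hneg ⊢
  rcases le_or_gt (h * r) 2 with h1 | h1
  · nlinarith [mul_nonneg hp (sub_nonneg.2 h1)]
  rcases le_or_gt (h * a) 2 with h2 | h2
  · nlinarith [mul_nonneg (sub_nonneg.2 hpa) (sub_nonneg.2 h1.le),
      mul_nonneg hr (sub_nonneg.2 h2)]
  have h3 := mul_nonneg (sub_nonneg.2 hpa) (sub_nonneg.2 h1.le)
  have h4 := mul_nonneg (sub_nonneg.2 hrb) (sub_nonneg.2 h2.le)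
  rcases hne with hne | hne
  · have := mul_pos (sub_pos.2 (lt_of_le_of_ne hpa hne)) (sub_pos.2 h1)
    nlinarith
  · have := mul_pos (sub_pos.2 (lt_of_le_of_ne hrb hne)) (sub_pos.2 h2)
    nlinarith

section Energy

variable {K L : ℕ} [NeZero K] [NeZero L] {u : Fin K × Fin L} {a b j : ℕ} {h : ℝ}

lemma dropletEnergy_growingRect_le (ha : a + 1 ≤ K) (hb : b ≤ L) (hj : j ≤ b) :
    dropletEnergy h (growingRect u a b j) ≤ rectEnergy h a b + 2 - h * j := by
  have h1 : (perimeter (growingRect u a b j) : ℝ) ≤ 2 * (a + 1 + b) := by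
    exact_mod_cast perimeter_growingRect_le ha hb hj
  rw [dropletEnergy, card_growingRect ha hb hj, rectEnergy]
  push_cast
  linarith

lemma exists_le_dropletEnergy_of_subset_growingRect (h0 : 0 < h) (ha : a + 1 < K) (hb : b < L)
    (hj : j ≤ b) {S : Finset (Fin K × Fin L)} (hS : S ⊆ growingRect u a b j) :
    ∃ p r i : ℕ, p ≤ a ∧ r ≤ b ∧ i ≤ j ∧
      rectEnergy h p r + ((if i = 0 then 0 else 2) - h * i) ≤ dropletEnergy h S ∧
      ((S ∩ arc u.1 a ×ˢ arc u.2 b).Nonempty → 1 ≤ p ∧ 1 ≤ r) := by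
  obtain ⟨p, r, i, hp, hr, hi, hcard, hper, hne⟩ :=
    exists_dimensions_of_subset_growingRect ha hb hj hS
  refine ⟨p, r, i, hp, hr, hi, ?_, hne⟩
  have hcard' : (#S : ℝ) ≤ p * r + i := by exact_mod_cast hcard
  have hper' : (2 : ℝ) * (p + r) + (if i = 0 then 0 else 2) ≤ perimeter S := by
    have h1 : 2 * (p + r) + (if i = 0 then 0 else 2) ≤ perimeter S := by
      split_ifs at hper ⊢ <;> omega
    exact_mod_cast h1
  have := mul_le_mul_of_nonneg_left hcard' h0.le
  rw [dropletEnergy, rectEnergy]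
  linarith

/-- The cost of completing a subset of a growing rectangle. -/
lemma dropletEnergy_growingRect_sub_le (h0 : 0 < h) (ha : a + 1 < K)
    (hb : b < L) (hj : j ≤ b) {S : Finset (Fin K × Fin L)}
    (hS : S ⊆ growingRect u a b j) :
    dropletEnergy h (growingRect u a b j) - dropletEnergy h S ≤
      max (rectEnergy h a b) 0 + max (2 - h * j) 0 := by
  obtain ⟨p, r, i, hp, hr, hi, hE, -⟩ :=
    exists_le_dropletEnergy_of_subset_growingRect h0 ha hb hj hS
  have hD := dropletEnergy_growingRect_le (u := u) (h := h) ha.le hb.le hj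
  have hmin := min_zero_rectEnergy_le (h := h) (Nat.cast_nonneg p) (Nat.cast_le.2 hp)
    (Nat.cast_nonneg r) (Nat.cast_le.2 hr)
  have h1 : min 0 (2 - h * j) ≤ (if i = 0 then 0 else 2) - h * i := by
    split_ifs with hi0
    · simp [hi0]
    · have : h * i ≤ h * j := mul_le_mul_of_nonneg_left (Nat.cast_le.2 hi) h0.le
      exact (min_le_right _ _).trans (by linarith)
  have h2 := max_add_min (rectEnergy h a b) 0
  have h3 := max_add_min (2 - h * j) 0
  rw [min_comm] at h2 h3
  linarith

/-- While a rectangle of subcritical width grows, completing a subset that already meets the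
rectangle costs strictly less than the first cell of the new column does for the empty subset. -/
lemma dropletEnergy_growingRect_sub_lt (h0 : 0 < h) (h2 : h < 2) (ha : a + 1 < K)
    (hb : b < L) (hj1 : 1 ≤ j) (hj : j ≤ b) (hha : h * a < 2) {S : Finset (Fin K × Fin L)}
    (hS : S ⊆ growingRect u a b j) (hne : (S ∩ arc u.1 a ×ˢ arc u.2 b).Nonempty)
    (hpos : 0 < rectEnergy h a b) :
    dropletEnergy h (growingRect u a b j) - dropletEnergy h S < rectEnergy h a b + (2 - h) := by
  rcases hj1.eq_or_lt with rfl | hj2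
  · obtain ⟨p, r, i, hp, hr, hi, hE, hpr⟩ :=
      exists_le_dropletEnergy_of_subset_growingRect h0 ha hb hj hS
    obtain ⟨hp1, hr1⟩ := hpr hne
    have hD := dropletEnergy_growingRect_le (u := u) (h := h) ha.le hb.le hj
    have h3 : 0 ≤ (if i = 0 then 0 else 2) - h * i := by
      obtain rfl | rfl : i = 0 ∨ i = 1 := by omega
      · simp
      · simp [h2.le]
    have h4 : 0 < rectEnergy h p r := by
      have h5 : h * p ≤ h * a := mul_le_mul_of_nonneg_left (Nat.cast_le.2 hp) h0.le
      have h6 : (1 : ℝ) ≤ p := by exact_mod_cast hp1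
      have h7 : 0 ≤ (r : ℝ) * (2 - h * p) := mul_nonneg (Nat.cast_nonneg _) (by linarith)
      unfold rectEnergy
      linarith
    push_cast at hD
    linarith
  · have h3 := dropletEnergy_growingRect_sub_le h0 ha hb hj hS
    have h4 : h * 1 < h * j := mul_lt_mul_of_pos_left (by exact_mod_cast hj2) h0
    have h5 : max (2 - h * j) 0 < 2 - h := max_lt (by linarith) (by linarith)
    rw [max_eq_left hpos.le] at h3
    linarith

/-- A rectangle of negative energy has less energy than all its proper subsets. -/
lemma dropletEnergy_rect_lt (h0 : 0 < h) (ha : a + 1 < K) (hb : b < L)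
    {S : Finset (Fin K × Fin L)} (hS : S ⊂ arc u.1 a ×ˢ arc u.2 b)
    (hneg : rectEnergy h a b < 0) :
    dropletEnergy h (arc u.1 a ×ˢ arc u.2 b) < dropletEnergy h S := by
  have ha1 : 1 ≤ a := by
    by_contra! h1
    obtain rfl : a = 0 := by omega
    have : (0 : ℝ) ≤ b := Nat.cast_nonneg b
    simp only [rectEnergy, Nat.cast_zero] at hneg
    linarith
  have hD : dropletEnergy h (arc u.1 a ×ˢ arc u.2 b) ≤ rectEnergy h a b := by
    have h1 := dropletEnergy_growingRect_le (u := u) (a := a - 1) (h := h)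
      (by omega : a - 1 + 1 ≤ K) hb.le le_rfl
    rw [growingRect_self, Nat.sub_add_cancel ha1, Nat.cast_sub ha1] at h1
    refine h1.trans (le_of_eq ?_)
    simp only [rectEnergy, Nat.cast_one]
    ring
  have hS' : S ⊆ growingRect u a b 0 := by
    rw [growingRect_zero]
    exact hS.subset
  obtain ⟨p, r, i, hp, hr, hi, hcard, hper, -⟩ :=
    exists_dimensions_of_subset_growingRect ha hb (Nat.zero_le _) hS'
  obtain rfl : i = 0 := by omega
  have hper' : (2 : ℝ) * (p + r) ≤ perimeter S := by
    simp only [if_true, add_zero] at hper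
    exact_mod_cast hper
  refine lt_of_le_of_lt hD ?_
  by_cases hne : p = a ∧ r = b
  · obtain ⟨rfl, rfl⟩ := hne
    have hlt : #S < p * r := by
      have := Finset.card_lt_card hS
      rwa [card_product, card_arc _ (by omega), card_arc _ hb.le] at this
    have hlt' : (#S : ℝ) < p * r := by exact_mod_cast hlt
    have := mul_lt_mul_of_pos_left hlt' h0
    rw [dropletEnergy, rectEnergy]
    linarith
  · have h1 : rectEnergy h a b < rectEnergy h p r := by
      refine rectEnergy_lt (Nat.cast_nonneg _) (Nat.cast_le.2 hp) (Nat.cast_nonneg _)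
        (Nat.cast_le.2 hr) hneg ?_
      rw [Ne, Ne, Nat.cast_inj, Nat.cast_inj]
      tauto
    have hcard' : (#S : ℝ) ≤ p * r := by exact_mod_cast hcard
    have := mul_le_mul_of_nonneg_left hcard' h0.le
    refine h1.trans_le ?_
    rw [dropletEnergy, rectEnergy]
    linarith

end Energy

/-! ### Paths and energy barriers -/

section Landscape

variable {X : Type*} {H : X → ℝ} {Q : X → X → ℝ}

/-- `τ` can be reached from `σ` by allowed steps into configurations satisfying `P`. -/
def Reaches (Q : X → X → ℝ) (P : X → Prop) : X → X → Prop :=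
  Relation.ReflTransGen fun σ τ => 0 < Q σ τ ∧ P τ

lemma Reaches.mono {P P' : X → Prop} (hPP' : ∀ η, P η → P' η) {σ τ : X}
    (hr : Reaches Q P σ τ) : Reaches Q P' σ τ :=
  Relation.ReflTransGen.mono (r := fun σ τ => 0 < Q σ τ ∧ P τ)
    (p := fun σ τ => 0 < Q σ τ ∧ P' τ) (fun _ _ h => ⟨h.1, hPP' _ h.2⟩) _ _ hr

lemma Reaches.exists_path {P : X → Prop} {σ τ : X} (hr : Reaches Q P σ τ) (hσ : P σ) :
    ∃ p : LandscapePath Q σ τ, ∀ i, P (p.ω i) := by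
  induction hr with
  | refl => exact ⟨⟨0, fun _ => σ, rfl, rfl, fun i => i.elim0⟩, fun _ => hσ⟩
  | @tail τ ρ _ hstep ih =>
    obtain ⟨p, hp⟩ := ih
    have hall : ∀ i : Fin (p.n + 2), P ((Fin.snoc p.ω ρ : Fin (p.n + 2) → X) i) := by
      intro i
      refine Fin.lastCases ?_ (fun i => ?_) i
      · rw [Fin.snoc_last]
        exact hstep.2
      · rw [Fin.snoc_castSucc]
        exact hp i
    refine ⟨⟨p.n + 1, Fin.snoc p.ω ρ, ?_, ?_, ?_⟩, hall⟩
    · rw [← Fin.castSucc_zero, Fin.snoc_castSucc, p.start]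
    · rw [Fin.snoc_last]
    · intro i
      refine Fin.lastCases ?_ (fun i => ?_) i
      · rw [Fin.succ_last, Fin.snoc_last, Fin.snoc_castSucc, p.finish]
        exact hstep.1
      · rw [Fin.succ_castSucc, Fin.snoc_castSucc, Fin.snoc_castSucc]
        exact p.step i

lemma energyBarrier_le_height_sub {σ τ : X} {A : Set X} (hτ : τ ∈ A) (p : LandscapePath Q σ τ) :
    energyBarrier H Q σ A ≤ ((p.height H - H σ : ℝ) : EReal) := by
  rw [EReal.coe_sub]
  refine EReal.sub_le_sub ?_ le_rfl
  exact (iInf₂_le τ hτ).trans (iInf_le _ p)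

lemma energyBarrier_le_of_reaches {σ τ : X} {A : Set X} {c : ℝ} (hc : 0 ≤ c) (hτ : τ ∈ A)
    (hr : Reaches Q (fun η => H η ≤ H σ + c) σ τ) : energyBarrier H Q σ A ≤ (c : EReal) := by
  obtain ⟨p, hp⟩ := hr.exists_path (by linarith)
  refine (energyBarrier_le_height_sub hτ p).trans (EReal.coe_le_coe_iff.2 ?_)
  have : p.height H ≤ H σ + c := Finset.sup'_le _ _ fun i _ => hp i
  linarith

lemma energyBarrier_lt_of_reaches {σ τ : X} {A : Set X} {c : ℝ} (hc : 0 < c) (hτ : τ ∈ A)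
    (hr : Reaches Q (fun η => H η < H σ + c) σ τ) : energyBarrier H Q σ A < (c : EReal) := by
  obtain ⟨p, hp⟩ := hr.exists_path (by linarith)
  refine (energyBarrier_le_height_sub hτ p).trans_lt (EReal.coe_lt_coe_iff.2 ?_)
  have : p.height H < H σ + c := (Finset.sup'_lt_iff _).2 fun i _ => hp i
  linarith

lemma le_energyBarrier {σ : X} {A : Set X} {c : ℝ}
    (hp : ∀ τ ∈ A, ∀ p : LandscapePath Q σ τ, ∃ i, H σ + c ≤ H (p.ω i)) :
    (c : EReal) ≤ energyBarrier H Q σ A := by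
  have h1 : ((c : ℝ) : EReal) = ((H σ + c : ℝ) : EReal) - (H σ : EReal) := by
    rw [← EReal.coe_sub]
    congr 1
    ring
  rw [h1]
  refine EReal.sub_le_sub (le_iInf₂ fun τ hτ => le_iInf fun p => ?_) le_rfl
  obtain ⟨i, hi⟩ := hp τ hτ p
  exact EReal.coe_le_coe_iff.2 (hi.trans (Finset.le_sup' (fun i => H (p.ω i)) (mem_univ i)))

lemma energyBarrier_anti (σ : X) {A B : Set X} (hAB : A ⊆ B) :
    energyBarrier H Q σ B ≤ energyBarrier H Q σ A :=
  EReal.sub_le_sub (iInf_le_iInf_of_subset hAB) le_rfl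

lemma stabilityLevel_of_mem_stableSet {σ : X} (hσ : σ ∈ stableSet H) :
    stabilityLevel H Q σ = ⊤ := by
  have hempty : {η | H η < H σ} = (∅ : Set X) := by
    ext η
    simpa using hσ η
  rw [stabilityLevel, hempty, energyBarrier, commHeightSet]
  simp

/-- If from every unstable configuration the energy can be lowered without climbing by more
than `c`, then so can the stable set be reached. -/
lemma exists_reaches_stableSet [Finite X] {c : ℝ}
    (hdesc : ∀ σ, σ ∉ stableSet H → ∃ η, H η < H σ ∧ Reaches Q (fun ρ => H ρ ≤ H σ + c) σ η)
    (σ : X) : ∃ η ∈ stableSet H, Reaches Q (fun ρ => H ρ ≤ H σ + c) σ η := by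
  have hwf : WellFounded fun σ τ : X => H σ < H τ :=
    Finite.wellFounded_of_trans_of_irrefl (r := InvImage (· < ·) H)
  induction σ using hwf.induction with
  | _ σ ih =>
    by_cases hσ : σ ∈ stableSet H
    · exact ⟨σ, hσ, Relation.ReflTransGen.refl⟩
    · obtain ⟨η, hη, hr⟩ := hdesc σ hσ
      obtain ⟨ρ, hρ, hr'⟩ := ih η hη
      exact ⟨ρ, hρ, Relation.ReflTransGen.trans hr
        (Reaches.mono (fun _ h => h.trans (by linarith)) hr')⟩

/-- A discrete intermediate value theorem along paths. -/
lemma LandscapePath.exists_eq {σ τ : X} (p : LandscapePath Q σ τ) (f : X → ℕ)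
    (hf : ∀ η ρ, 0 < Q η ρ → f ρ ≤ f η + 1) {m : ℕ} (hσ : f σ ≤ m) (hτ : m ≤ f τ) :
    ∃ i, f (p.ω i) = m := by
  by_contra! hne
  have hlt : ∀ i, f (p.ω i) < m := by
    intro i
    induction i using Fin.induction with
    | zero => exact lt_of_le_of_ne (by rwa [p.start]) (hne 0)
    | succ i ih =>
      have := hf _ _ (p.step i)
      exact lt_of_le_of_ne (by omega) (hne _)
  have := hlt (Fin.last p.n)
  rw [p.finish] at this
  omega

end Landscape

section Filling

variable {q K L : ℕ}

lemma pottsQ_pos_iff [NeZero K] [NeZero L] {σ τ : PottsConfig q K L} (hq : 0 < q) :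
    0 < pottsQ q K L σ τ ↔ #{v | σ v ≠ τ v} = 1 := by
  have hpos : 0 < 1 / ((q : ℝ) * (Fintype.card (Fin K × Fin L) : ℝ)) := by
    have : 0 < Fintype.card (Fin K × Fin L) := Fintype.card_pos
    positivity
  unfold pottsQ
  split_ifs with h
  · exact ⟨fun _ => by convert h, fun _ => hpos⟩
  · refine ⟨fun h' => absurd h' (lt_irrefl _), fun h' => absurd ?_ h⟩
    convert h'

lemma reaches_fill_of_card_le [NeZero K] [NeZero L] (hq : 0 < q) {P : PottsConfig q K L → Prop}
    (s : PottsSpin q) (σ : PottsConfig q K L) {D D' : Finset (Fin K × Fin L)} (hsub : D ⊆ D')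
    (hcard : #D' ≤ #D + 1) (hP : P (fill s σ D')) :
    Reaches (pottsQ q K L) P (fill s σ D) (fill s σ D') := by
  by_cases heq : fill s σ D = fill s σ D'
  · rw [heq]
    exact Relation.ReflTransGen.refl
  refine Relation.ReflTransGen.single ⟨(pottsQ_pos_iff hq).2 (le_antisymm ?_ ?_), hP⟩
  · have h1 : ({v | fill s σ D v ≠ fill s σ D' v} : Finset (Fin K × Fin L)) ⊆ D' \ D := by
      intro v hv
      rw [mem_filter] at hv
      rw [mem_sdiff]
      by_contra hv'
      apply hv.2
      by_cases h2 : v ∈ D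
      · simp [fill, h2, hsub h2]
      · have h3 : v ∉ D' := fun h => hv' ⟨h, h2⟩
        simp [fill, h2, h3]
    have h2 := Finset.card_le_card h1
    rw [Finset.card_sdiff_of_subset hsub] at h2
    omega
  · obtain ⟨v, hv⟩ := Function.ne_iff.1 heq
    exact Finset.card_pos.2 ⟨v, by simpa using hv⟩

lemma growingRect_mono [NeZero K] [NeZero L] (u : Fin K × Fin L) {a b j : ℕ} :
    growingRect u a b j ⊆ growingRect u a b (j + 1) :=
  Finset.union_subset_union subset_rfl
    (Finset.product_subset_product subset_rfl (arc_mono _ (Nat.le_succ j)))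

lemma transpose_product {K L : ℕ} (A : Finset (Fin K)) (B : Finset (Fin L)) :
    transpose (A ×ˢ B) = B ×ˢ A := by
  ext ⟨x, y⟩
  rw [mem_transpose, mem_product, mem_product, and_comm]

/-- A rectangle can be widened by one column, cell by cell. -/
lemma reaches_fill_widen [NeZero K] [NeZero L] (hq : 0 < q) {P : PottsConfig q K L → Prop}
    (s : PottsSpin q) (σ : PottsConfig q K L) (u : Fin K × Fin L) {a b : ℕ} (ha : a + 1 ≤ K)
    (hb : b ≤ L) (hP : ∀ j, 1 ≤ j → j ≤ b → P (fill s σ (growingRect u a b j))) :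
    Reaches (pottsQ q K L) P (fill s σ (arc u.1 a ×ˢ arc u.2 b))
      (fill s σ (arc u.1 (a + 1) ×ˢ arc u.2 b)) := by
  have key : ∀ j, j ≤ b → Reaches (pottsQ q K L) P (fill s σ (growingRect u a b 0))
      (fill s σ (growingRect u a b j)) := by
    intro j
    induction j with
    | zero => exact fun _ => Relation.ReflTransGen.refl
    | succ j ih =>
      intro hj
      refine Relation.ReflTransGen.trans (ih (by omega))
        (reaches_fill_of_card_le hq s σ (growingRect_mono u) ?_ (hP _ (by omega) hj))
      rw [card_growingRect ha hb hj, card_growingRect ha hb (by omega)]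
      omega
  have h1 := key b le_rfl
  rwa [growingRect_zero, growingRect_self] at h1

/-- A rectangle can be heightened by one row, cell by cell. -/
lemma reaches_fill_heighten [NeZero K] [NeZero L] (hq : 0 < q) {P : PottsConfig q K L → Prop}
    (s : PottsSpin q) (σ : PottsConfig q K L) (u : Fin K × Fin L) {a b : ℕ} (ha : a + 1 ≤ L)
    (hb : b ≤ K)
    (hP : ∀ j, 1 ≤ j → j ≤ b → P (fill s σ (transpose (growingRect u.swap a b j)))) :
    Reaches (pottsQ q K L) P (fill s σ (arc u.1 b ×ˢ arc u.2 a))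
      (fill s σ (arc u.1 b ×ˢ arc u.2 (a + 1))) := by
  have key : ∀ j, j ≤ b →
      Reaches (pottsQ q K L) P (fill s σ (transpose (growingRect u.swap a b 0)))
        (fill s σ (transpose (growingRect u.swap a b j))) := by
    intro j
    induction j with
    | zero => exact fun _ => Relation.ReflTransGen.refl
    | succ j ih =>
      intro hj
      refine Relation.ReflTransGen.trans (ih (by omega))
        (reaches_fill_of_card_le hq s σ (transpose_subset (growingRect_mono _)) ?_
          (hP _ (by omega) hj))
      rw [card_transpose, card_transpose, card_growingRect ha hb hj,
        card_growingRect ha hb (by omega)]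
      omega
  have h1 := key b le_rfl
  rwa [growingRect_zero, growingRect_self, transpose_product, transpose_product] at h1

/-- A droplet can be grown to a square through squares and quasi-squares. -/
lemma reaches_fill_square [NeZero K] [NeZero L] (hq : 0 < q) {P : PottsConfig q K L → Prop}
    (s : PottsSpin q) (σ : PottsConfig q K L) (u : Fin K × Fin L) {N : ℕ} (hK : N ≤ K)
    (hL : N ≤ L)
    (hP : ∀ n j, n < N → 1 ≤ j → j ≤ n → P (fill s σ (growingRect u n n j)))
    (hP' : ∀ n j, n < N → 1 ≤ j → j ≤ n + 1 →
      P (fill s σ (transpose (growingRect u.swap n (n + 1) j)))) :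
    Reaches (pottsQ q K L) P σ (fill s σ (arc u.1 N ×ˢ arc u.2 N)) := by
  have key : ∀ n, n ≤ N → Reaches (pottsQ q K L) P σ (fill s σ (arc u.1 n ×ˢ arc u.2 n)) := by
    intro n
    induction n with
    | zero =>
      intro _
      have h0 : fill s σ (arc u.1 0 ×ˢ arc u.2 0) = σ := by
        funext v
        simp [fill]
      rw [h0]
      exact Relation.ReflTransGen.refl
    | succ n ih =>
      intro hn
      exact (Relation.ReflTransGen.trans (ih (by omega))
        (reaches_fill_widen hq s σ u (by omega) (by omega) fun j => hP n j hn)).trans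
        (reaches_fill_heighten hq s σ u (by omega) (by omega) fun j => hP' n j hn)
  exact key N le_rfl

end Filling

/-! ### The critical droplet -/

section Arithmetic

variable {h : ℝ} {ℓ : ℕ}

lemma rectEnergy_comm (h a b : ℝ) : rectEnergy h a b = rectEnergy h b a := by
  unfold rectEnergy
  ring

lemma rectEnergy_square_lt (h0 : 0 < h) (hℓ : 2 < h * ℓ) (hℓ' : h * (ℓ - 1) < 2) (n : ℕ) :
    rectEnergy h n n < rectEnergy h ℓ (ℓ - 1) := by
  unfold rectEnergy
  rcases Nat.lt_or_ge n ℓ with hn | hn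
  · have hd : (0 : ℝ) ≤ ℓ - 1 - n := by
      have : (n : ℝ) + 1 ≤ ℓ := by exact_mod_cast hn
      linarith
    have h1 := mul_pos (sub_pos.2 hℓ') (by linarith : (0 : ℝ) < 1 + 2 * (ℓ - 1 - n))
    have h2 := mul_nonneg h0.le (sq_nonneg ((ℓ : ℝ) - 1 - n))
    nlinarith
  · have hd : (0 : ℝ) ≤ n - ℓ := sub_nonneg.2 (by exact_mod_cast hn)
    have h1 := mul_pos (sub_pos.2 hℓ) (by linarith : (0 : ℝ) < 1 + 2 * (n - ℓ))
    have h2 := mul_nonneg h0.le (sq_nonneg ((n : ℝ) - ℓ))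
    nlinarith

lemma rectEnergy_quasiSquare_lt (h0 : 0 < h) (hℓ : 2 < h * ℓ) (hℓ' : h * (ℓ - 1) < 2) {n : ℕ}
    (hn : n + 1 ≠ ℓ) : rectEnergy h n (n + 1) < rectEnergy h ℓ (ℓ - 1) := by
  unfold rectEnergy
  rcases Nat.lt_or_ge (n + 1) ℓ with hn' | hn'
  · have hd : (0 : ℝ) ≤ ℓ - 2 - n := by
      have : (n : ℝ) + 1 + 1 ≤ ℓ := by exact_mod_cast hn'
      linarith
    have h1 := mul_pos (sub_pos.2 hℓ') (by linarith : (0 : ℝ) < (ℓ - 1 - n))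
    have h2 := mul_nonneg h0.le (mul_nonneg hd (by linarith : (0 : ℝ) ≤ ℓ - 1 - n))
    nlinarith
  · have hd : (0 : ℝ) ≤ n - ℓ := sub_nonneg.2 (by
      have : ℓ ≤ n := by omega
      exact_mod_cast this)
    have h1 := mul_pos (sub_pos.2 hℓ) (by linarith : (0 : ℝ) < n - ℓ + 1)
    have h2 := mul_nonneg h0.le (mul_nonneg hd (by linarith : (0 : ℝ) ≤ n - ℓ + 1))
    nlinarith

lemma rectEnergy_critical_pos (h0 : 0 < h) (hℓ : 2 < h * ℓ) (hℓ' : h * (ℓ - 1) < 2) :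
    0 < rectEnergy h ℓ (ℓ - 1) := by
  have h1 := rectEnergy_square_lt h0 hℓ hℓ' 0
  simpa [rectEnergy] using h1

lemma rectEnergy_quasiSquare_le (h0 : 0 < h) (hℓ : 2 < h * ℓ) (hℓ' : h * (ℓ - 1) < 2) (n : ℕ) :
    rectEnergy h n (n + 1) ≤ rectEnergy h ℓ (ℓ - 1) := by
  by_cases hn : n + 1 = ℓ
  · rw [← hn, rectEnergy_comm]
    push_cast
    rw [add_sub_cancel_right]
  · exact (rectEnergy_quasiSquare_lt h0 hℓ hℓ' hn).le

/-- The energy of a square of twice the critical length is negative. -/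
lemma rectEnergy_two_mul_neg (hℓ : 2 < h * ℓ) (hℓ1 : 1 ≤ ℓ) :
    rectEnergy h ((2 * ℓ : ℕ) : ℝ) ((2 * ℓ : ℕ) : ℝ) < 0 := by
  have h1 : (0 : ℝ) < ℓ := by exact_mod_cast hℓ1
  unfold rectEnergy
  push_cast
  nlinarith [mul_pos h1 (sub_pos.2 hℓ)]

end Arithmetic

section Barrier

variable {K L ℓ : ℕ} [NeZero K] [NeZero L] {h : ℝ}

/-- Droplets up to the critical size do not have negative energy. -/
lemma dropletEnergy_nonneg (h0 : 0 < h) (h1 : h < 1) (hℓ1 : 1 ≤ ℓ)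
    (hℓ : 2 < h * ℓ) (hℓ' : h * (ℓ - 1) < 2) (hK : 3 * ℓ ≤ K) (hL : 3 * ℓ ≤ L)
    {S : Finset (Fin K × Fin L)} (hS : #S ≤ ℓ * (ℓ - 1) + 1) : 0 ≤ dropletEnergy h S := by
  have hpos := rectEnergy_critical_pos h0 hℓ hℓ'
  obtain ⟨m, rfl⟩ : ∃ m, ℓ = m + 1 := ⟨ℓ - 1, by omega⟩
  rw [Nat.add_sub_cancel] at hS
  have hS' : (#S : ℝ) ≤ (m + 1) * m + 1 := by exact_mod_cast hS
  have hhS := mul_le_mul_of_nonneg_left hS' h0.le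
  unfold rectEnergy at hpos
  unfold dropletEnergy
  push_cast at *
  have hbig : ∀ P : ℝ, 4 * (m + 1) ≤ P → 0 ≤ P - h * #S := by
    intro P hP
    nlinarith
  rcases perimeter_lower_bound hK hL (S := S) (by nlinarith) with hper | ⟨a, b, hab, hper⟩
  · exact hbig _ (by exact_mod_cast hper)
  have hper' : (2 : ℝ) * (a + b) ≤ perimeter S := by exact_mod_cast hper
  rcases Nat.lt_or_ge (a + b) (2 * m + 2) with hlt | hge
  · have hlt' : (a : ℝ) + b ≤ 2 * m + 1 := by
      have : a + b ≤ 2 * m + 1 := by omega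
      exact_mod_cast this
    have hab' : (#S : ℝ) ≤ a * b := by exact_mod_cast hab
    have h2 := mul_le_mul_of_nonneg_left hab' h0.le
    have h3 := mul_nonneg h0.le (sq_nonneg ((a : ℝ) - b))
    have hs : (0 : ℝ) ≤ a + b := by positivity
    have h4 : h * (a + b) ≤ 8 := by nlinarith
    have h5 := mul_nonneg hs (sub_nonneg.2 h4)
    nlinarith
  · have hge' : 2 * (m : ℝ) + 2 ≤ a + b := by exact_mod_cast hge
    exact hbig _ (by linarith)

/-- A droplet of the critical size has at least the energy of a quasi-square with a
protuberance. -/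
lemma le_dropletEnergy_of_card_eq (hℓ1 : 1 ≤ ℓ) (hK : 3 * ℓ ≤ K) (hL : 3 * ℓ ≤ L)
    {S : Finset (Fin K × Fin L)} (hS : #S = ℓ * (ℓ - 1) + 1) :
    rectEnergy h ℓ (ℓ - 1) + (2 - h) ≤ dropletEnergy h S := by
  obtain ⟨m, rfl⟩ : ∃ m, ℓ = m + 1 := ⟨ℓ - 1, by omega⟩
  rw [Nat.add_sub_cancel] at hS
  have hper : 4 * (m + 1) ≤ perimeter S := by
    rcases perimeter_lower_bound hK hL (S := S) (by nlinarith) with hper | ⟨a, b, hab, hper⟩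
    · exact hper
    · by_contra! hlt
      have h1 : a + b ≤ 2 * m + 1 := by omega
      -- `a + b` is at most the odd number `2m + 1`, so `ab` is at most `m(m + 1)`.
      have h2 : a * b ≤ (m + 1) * m := by
        rcases Nat.lt_or_ge a (m + 1) with ha | ha
        · obtain ⟨d, rfl⟩ : ∃ d, m = a + d := ⟨m - a, by omega⟩
          nlinarith
        · obtain ⟨d, rfl⟩ : ∃ d, a = m + 1 + d := ⟨a - (m + 1), by omega⟩
          nlinarith
      omega
  have hper' : (4 : ℝ) * (m + 1) ≤ perimeter S := by exact_mod_cast hper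
  rw [dropletEnergy, hS, rectEnergy]
  push_cast
  linarith

end Barrier

lemma Fin.val_one_le {K : ℕ} [NeZero K] : (1 : Fin K).val ≤ 1 := by
  rw [Fin.val_one']
  exact Nat.mod_le _ _

section Descent

variable {q K L ℓ : ℕ} [NeZero K] [NeZero L] {h : ℝ} {u : Fin K × Fin L} {a b j : ℕ}

lemma transpose_inter_eq {K L : ℕ} (D : Finset (Fin L × Fin K)) (A : Finset (Fin K × Fin L)) :
    transpose D ∩ A = transpose (D ∩ transpose A) := by
  ext ⟨x, y⟩
  simp

lemma pottsH_fill_growingRect_le (h0 : 0 < h) (hK3 : 3 ≤ K) (hL3 : 3 ≤ L) {s : PottsSpin q}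
    (hs : (s : ℕ) = 1) (σ : PottsConfig q K L) (ha : a + 1 < K) (hb : b < L) (hj : j ≤ b) :
    pottsH q K L h (fill s σ (growingRect u a b j)) ≤
      pottsH q K L h σ + (max (rectEnergy h a b) 0 + max (2 - h * j) 0) :=
  (pottsH_fill_le hK3 hL3 h hs σ _).trans
    (by have := dropletEnergy_growingRect_sub_le h0 ha hb hj
          (S := growingRect u a b j ∩ onesSet σ) Finset.inter_subset_left
        linarith)

lemma pottsH_fill_transpose_growingRect_le (h0 : 0 < h) (hK3 : 3 ≤ K) (hL3 : 3 ≤ L)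
    {s : PottsSpin q} (hs : (s : ℕ) = 1) (σ : PottsConfig q K L) (ha : a + 1 < L) (hb : b < K)
    (hj : j ≤ b) :
    pottsH q K L h (fill s σ (transpose (growingRect u.swap a b j))) ≤
      pottsH q K L h σ + (max (rectEnergy h a b) 0 + max (2 - h * j) 0) := by
  refine (pottsH_fill_le hK3 hL3 h hs σ _).trans ?_
  rw [transpose_inter_eq, dropletEnergy_transpose, dropletEnergy_transpose]
  have := dropletEnergy_growingRect_sub_le h0 ha hb hj
    (S := growingRect u.swap a b j ∩ transpose (onesSet σ)) Finset.inter_subset_left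
  linarith

/-- Around an edge with different spins even the critical quasi-square grows at a cost below the
critical one. -/
lemma pottsH_fill_critical_lt (h0 : 0 < h) (h2 : h < 2) (hK3 : 3 ≤ K) (hL3 : 3 ≤ L)
    {s : PottsSpin q} (hs : (s : ℕ) = 1) (σ : PottsConfig q K L) (ha : a + 1 < L) (hb : b < K)
    (hj1 : 1 ≤ j) (hj : j ≤ b) (ha2 : 2 ≤ a) (hb2 : 2 ≤ b) (hha : h * a < 2)
    (hpos : 0 < rectEnergy h a b) {w : Fin K × Fin L}
    (hedge : w = (u.1 + 1, u.2) ∨ w = (u.1, u.2 + 1)) (huw : σ u ≠ σ w) :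
    pottsH q K L h (fill s σ (transpose (growingRect u.swap a b j))) <
      pottsH q K L h σ + (rectEnergy h a b + (2 - h)) := by
  set D := growingRect u.swap a b j with hD
  set R := arc u.swap.1 a ×ˢ arc u.swap.2 b with hR
  have hRD : R ⊆ D := Finset.subset_union_left
  have hone_K := Fin.val_one_le (K := K)
  have hone_L := Fin.val_one_le (K := L)
  have hu : u.swap ∈ R := by
    simp only [hR, mem_product, mem_arc, sub_self, Fin.val_zero]
    omega
  have hw : w.swap ∈ R := by
    simp only [hR, mem_product, mem_arc]
    rcases hedge with rfl | rfl <;>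
      simp only [Prod.fst_swap, Prod.snd_swap, sub_self, add_sub_cancel_left,
        Fin.val_zero] <;> omega
  have hmem : ∀ {v : Fin K × Fin L}, v.swap ∈ R → v ∈ transpose D := by
    rintro ⟨x, y⟩ hv
    exact mem_transpose.2 (hRD hv)
  by_cases hA : ((D ∩ transpose (onesSet σ)) ∩ R).Nonempty
  · refine (pottsH_fill_le hK3 hL3 h hs σ _).trans_lt ?_
    rw [transpose_inter_eq, dropletEnergy_transpose, dropletEnergy_transpose]
    have := dropletEnergy_growingRect_sub_lt h0 h2 ha hb hj1 hj hha
      (S := D ∩ transpose (onesSet σ)) Finset.inter_subset_left hA hpos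
    linarith
  · have hnot : ∀ {v : Fin K × Fin L}, v.swap ∈ R → v ∉ onesSet σ := by
      rintro ⟨x, y⟩ hv hv1
      exact hA ⟨_, mem_inter.2 ⟨mem_inter.2 ⟨hRD hv, mem_transpose.2 hv1⟩, hv⟩⟩
    refine (pottsH_fill_lt hK3 hL3 h hs σ _ hedge (hmem hu) (hmem hw) (hnot hu) (hnot hw)
      huw).trans_le ?_
    rw [transpose_inter_eq, dropletEnergy_transpose, dropletEnergy_transpose]
    have h3 := dropletEnergy_growingRect_sub_le h0 ha hb hj
      (S := D ∩ transpose (onesSet σ)) Finset.inter_subset_left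
    have h4 : h * 1 ≤ h * j := mul_le_mul_of_nonneg_left (by exact_mod_cast hj1) h0.le
    have h5 : max (2 - h * j) 0 ≤ 2 - h := max_le (by linarith) (by linarith)
    rw [max_eq_left hpos.le] at h3
    linarith

/-- Once the droplet has become a large square, the energy lies below its starting value. -/
lemma pottsH_fill_square_lt (h0 : 0 < h) (hK3 : 3 ≤ K) (hL3 : 3 ≤ L) {s : PottsSpin q}
    (hs : (s : ℕ) = 1) (σ : PottsConfig q K L) {N : ℕ} (hK : N + 1 < K) (hL : N < L)
    (hneg : rectEnergy h N N < 0) {w : Fin K × Fin L} (hw : w ∈ arc u.1 N ×ˢ arc u.2 N)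
    (hw1 : w ∉ onesSet σ) :
    pottsH q K L h (fill s σ (arc u.1 N ×ˢ arc u.2 N)) < pottsH q K L h σ := by
  refine (pottsH_fill_le hK3 hL3 h hs σ _).trans_lt ?_
  have := dropletEnergy_rect_lt (u := u) h0 hK hL
    (S := arc u.1 N ×ˢ arc u.2 N ∩ onesSet σ)
    ((Finset.ssubset_iff_of_subset Finset.inter_subset_left).2
      ⟨w, hw, fun hmem => hw1 (mem_inter.1 hmem).2⟩) hneg
  linarith

/-- Every configuration other than the one of all spins `1` can reach lower energy by climbing at
most the critical barrier. -/
lemma exists_descent_le (hq : 0 < q) (h0 : 0 < h) (h2 : h < 2) (hℓ3 : 3 ≤ ℓ) (hℓ : 2 < h * ℓ)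
    (hℓ' : h * (ℓ - 1) < 2) (hK : 3 * ℓ ≤ K) (hL : 3 * ℓ ≤ L) {s : PottsSpin q}
    (hs : (s : ℕ) = 1) (σ : PottsConfig q K L) (hu : u ∉ onesSet σ) :
    ∃ η, pottsH q K L h η < pottsH q K L h σ ∧ Reaches (pottsQ q K L)
      (fun ρ => pottsH q K L h ρ ≤ pottsH q K L h σ + (rectEnergy h ℓ (ℓ - 1) + (2 - h))) σ η := by
  have hpos := rectEnergy_critical_pos h0 hℓ hℓ'
  have hmax : ∀ {e : ℝ} {j : ℕ}, 1 ≤ j → e ≤ rectEnergy h ℓ (ℓ - 1) →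
      max e 0 + max (2 - h * j) 0 ≤ rectEnergy h ℓ (ℓ - 1) + (2 - h) := by
    intro e j hj he
    have h4 : h * 1 ≤ h * j := mul_le_mul_of_nonneg_left (by exact_mod_cast hj) h0.le
    exact add_le_add (max_le he hpos.le) (max_le (by linarith) (by linarith))
  refine ⟨fill s σ (arc u.1 (2 * ℓ) ×ˢ arc u.2 (2 * ℓ)), ?_,
    reaches_fill_square hq s σ u (by omega) (by omega) ?_ ?_⟩
  · refine pottsH_fill_square_lt h0 (by omega) (by omega) hs σ (by omega) (by omega)
      (rectEnergy_two_mul_neg hℓ (by omega)) (w := u) ?_ hu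
    simp only [mem_product, mem_arc, sub_self, Fin.val_zero]
    omega
  · intro n j hn hj1 hj
    refine (pottsH_fill_growingRect_le h0 (by omega) (by omega) hs σ (by omega) (by omega)
      hj).trans (add_le_add le_rfl (hmax hj1 (rectEnergy_square_lt h0 hℓ hℓ' n).le))
  · intro n j hn hj1 hj
    refine (pottsH_fill_transpose_growingRect_le h0 (by omega) (by omega) hs σ (by omega)
      (by omega) hj).trans (add_le_add le_rfl (hmax hj1 ?_))
    push_cast
    exact rectEnergy_quasiSquare_le h0 hℓ hℓ' n

/-- A configuration with an edge of different spins can reach lower energy by climbing strictly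
less than the critical barrier: the droplet is grown around that edge. -/
lemma exists_descent_lt (hq : 0 < q) (h0 : 0 < h) (h2 : h < 2) (hℓ3 : 3 ≤ ℓ) (hℓ : 2 < h * ℓ)
    (hℓ' : h * (ℓ - 1) < 2) (hK : 3 * ℓ ≤ K) (hL : 3 * ℓ ≤ L) {s : PottsSpin q}
    (hs : (s : ℕ) = 1) (σ : PottsConfig q K L) {w : Fin K × Fin L}
    (hedge : w = (u.1 + 1, u.2) ∨ w = (u.1, u.2 + 1)) (huw : σ u ≠ σ w) :
    ∃ η, pottsH q K L h η < pottsH q K L h σ ∧ Reaches (pottsQ q K L)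
      (fun ρ => pottsH q K L h ρ < pottsH q K L h σ + (rectEnergy h ℓ (ℓ - 1) + (2 - h))) σ η := by
  have hpos := rectEnergy_critical_pos h0 hℓ hℓ'
  have hmax : ∀ {e : ℝ} {j : ℕ}, 1 ≤ j → e < rectEnergy h ℓ (ℓ - 1) →
      max e 0 + max (2 - h * j) 0 < rectEnergy h ℓ (ℓ - 1) + (2 - h) := by
    intro e j hj he
    have h4 : h * 1 ≤ h * j := mul_le_mul_of_nonneg_left (by exact_mod_cast hj) h0.le
    exact add_lt_add_of_lt_of_le (max_lt he hpos) (max_le (by linarith) (by linarith))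
  have hone_K := Fin.val_one_le (K := K)
  have hone_L := Fin.val_one_le (K := L)
  refine ⟨fill s σ (arc u.1 (2 * ℓ) ×ˢ arc u.2 (2 * ℓ)), ?_,
    reaches_fill_square hq s σ u (by omega) (by omega) ?_ ?_⟩
  · obtain ⟨v, hv, hv1⟩ : ∃ v ∈ arc u.1 (2 * ℓ) ×ˢ arc u.2 (2 * ℓ), v ∉ onesSet σ := by
      by_cases hu1 : u ∈ onesSet σ
      · refine ⟨w, ?_, fun hw1 => huw ?_⟩
        · simp only [mem_product, mem_arc]
          rcases hedge with rfl | rfl <;>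
            simp only [sub_self, add_sub_cancel_left, Fin.val_zero] <;> omega
        · rw [mem_onesSet] at hu1 hw1
          exact Subtype.ext (hu1.trans hw1.symm)
      · refine ⟨u, ?_, hu1⟩
        simp only [mem_product, mem_arc, sub_self, Fin.val_zero]
        omega
    exact pottsH_fill_square_lt h0 (by omega) (by omega) hs σ (by omega) (by omega)
      (rectEnergy_two_mul_neg hℓ (by omega)) hv hv1
  · intro n j hn hj1 hj
    exact (pottsH_fill_growingRect_le h0 (by omega) (by omega) hs σ (by omega) (by omega)
      hj).trans_lt (add_lt_add_of_le_of_lt le_rfl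
        (hmax hj1 (rectEnergy_square_lt h0 hℓ hℓ' n)))
  · intro n j hn hj1 hj
    by_cases hcrit : n + 1 = ℓ
    · have hnℓ : (n : ℝ) = ℓ - 1 := by rw [← hcrit]; push_cast; ring
      have hE : rectEnergy h (n : ℝ) ((n + 1 : ℕ) : ℝ) = rectEnergy h ℓ (ℓ - 1) := by
        rw [hcrit, hnℓ, rectEnergy_comm]
      rw [← hE]
      exact pottsH_fill_critical_lt h0 h2 (by omega) (by omega) hs σ (by omega) (by omega) hj1
        hj (by omega) (by omega) (by rwa [hnℓ]) (by rwa [hE]) hedge huw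
    · refine (pottsH_fill_transpose_growingRect_le h0 (by omega) (by omega) hs σ (by omega)
        (by omega) hj).trans_lt (add_lt_add_of_le_of_lt le_rfl (hmax hj1 ?_))
      push_cast
      exact rectEnergy_quasiSquare_lt h0 hℓ hℓ' hcrit

end Descent

/-! ### Stable and metastable states -/

lemma onesSet_constConfig {q K L : ℕ} {m : PottsSpin q} (hm : 2 ≤ (m : ℕ)) :
    onesSet (constConfig K L m) = ∅ := by
  ext v
  simp only [mem_onesSet, constConfig, notMem_empty, iff_false]
  omega

lemma eq_constConfig_one_iff {q K L : ℕ} {σ : PottsConfig q K L} {s : PottsSpin q} (hs : (s : ℕ) = 1) :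
    σ = constConfig K L s ↔ ∀ v, v ∈ onesSet σ := by
  simp only [mem_onesSet, ← hs, ← Subtype.ext_iff]
  exact funext_iff

section States

variable {q K L ℓ : ℕ} [NeZero K] [NeZero L] {h : ℝ}

lemma pottsH_constConfig_one (hK : 3 ≤ K) (hL : 3 ≤ L) (h : ℝ) {m : PottsSpin q}
    (hm : (m : ℕ) = 1) : pottsH q K L h (constConfig K L m) = -(h * (K * L)) - 2 * (K * L) := by
  rw [pottsH_eq hK hL]
  simp [interfaceLength, disagree, constConfig, onesSet, hm]

lemma pottsH_constConfig (hK : 3 ≤ K) (hL : 3 ≤ L) (h : ℝ) {m : PottsSpin q}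
    (hm : 2 ≤ (m : ℕ)) : pottsH q K L h (constConfig K L m) = -(2 * (K * L)) := by
  rw [pottsH_eq hK hL, onesSet_constConfig hm]
  simp [interfaceLength, disagree, constConfig]

lemma stableSet_pottsH (hK : 3 ≤ K) (hL : 3 ≤ L) (h0 : 0 < h) {s : PottsSpin q}
    (hs : (s : ℕ) = 1) : stableSet (pottsH q K L h) = {constConfig K L s} := by
  have hcard : ∀ σ : PottsConfig q K L, (#(onesSet σ) : ℝ) ≤ K * L := by
    intro σ
    have := Finset.card_le_univ (onesSet σ)
    rw [Fintype.card_prod, Fintype.card_fin, Fintype.card_fin] at this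
    exact_mod_cast this
  ext σ
  rw [Set.mem_singleton_iff]
  constructor
  · intro hσ
    have h1 := hσ (constConfig K L s)
    rw [pottsH_constConfig_one hK hL h hs, pottsH_eq hK hL] at h1
    have h2 := interfaceLength_nonneg σ
    have h3 : (K : ℝ) * L ≤ #(onesSet σ) := le_of_mul_le_mul_left (by linarith) h0
    have h4 : K * L ≤ #(onesSet σ) := by exact_mod_cast h3
    have h5 : onesSet σ = univ := by
      rw [← Finset.card_eq_iff_eq_univ, Fintype.card_prod, Fintype.card_fin, Fintype.card_fin]
      exact le_antisymm (by exact_mod_cast hcard σ) h4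
    rw [eq_constConfig_one_iff hs, h5]
    exact mem_univ
  · rintro rfl τ
    rw [pottsH_constConfig_one hK hL h hs, pottsH_eq hK hL]
    have h2 := interfaceLength_nonneg τ
    have h3 := mul_le_mul_of_nonneg_left (hcard τ) h0.le
    linarith

/-- A configuration that is not constant has an edge with different spins. -/
lemma exists_edge_ne (σ : PottsConfig q K L) (hσ : ∀ m, σ ≠ constConfig K L m) :
    ∃ u w : Fin K × Fin L, (w = (u.1 + 1, u.2) ∨ w = (u.1, u.2 + 1)) ∧ σ u ≠ σ w := by
  by_contra! hall
  have hx : ∀ y x, σ (x, y) = σ (0, y) := fun y =>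
    Fin.forall_of_forall_add_one (p := fun x => σ (x, y) = σ (0, y))
      (fun x hx => (hall (x, y) _ (Or.inl rfl)).symm.trans hx) (x₀ := 0) rfl
  have hy : ∀ y, σ (0, y) = σ (0, 0) :=
    Fin.forall_of_forall_add_one (p := fun y => σ (0, y) = σ (0, 0))
      (fun y hy => (hall (0, y) _ (Or.inr rfl)).symm.trans hy) (x₀ := 0) rfl
  exact hσ (σ (0, 0)) (funext fun v => (hx v.2 v.1).trans (hy v.2))

lemma card_onesSet_le_of_pottsQ_pos (hq : 0 < q) {σ τ : PottsConfig q K L}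
    (hQ : 0 < pottsQ q K L σ τ) : #(onesSet τ) ≤ #(onesSet σ) + 1 := by
  rw [pottsQ_pos_iff hq] at hQ
  rw [← hQ]
  refine (Finset.card_le_card fun v hv => ?_).trans (Finset.card_union_le _ _)
  rw [mem_union, mem_filter]
  by_cases heq : σ v = τ v
  · left
    rw [mem_onesSet] at hv ⊢
    rw [heq, hv]
  · exact Or.inr ⟨mem_univ _, heq⟩

/-- A path from a constant configuration to lower energy passes through a configuration with the
critical number of spins `1`. -/
lemma le_stabilityLevel_constConfig (hq : 0 < q) (h0 : 0 < h) (h1 : h < 1) (hℓ3 : 3 ≤ ℓ)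
    (hℓ : 2 < h * ℓ) (hℓ' : h * (ℓ - 1) < 2) (hK : 3 * ℓ ≤ K) (hL : 3 * ℓ ≤ L) {m : PottsSpin q}
    (hm : 2 ≤ (m : ℕ)) :
    ((rectEnergy h ℓ (ℓ - 1) + (2 - h) : ℝ) : EReal) ≤
      stabilityLevel (pottsH q K L h) (pottsQ q K L) (constConfig K L m) := by
  have hK3 : 3 ≤ K := by omega
  have hL3 : 3 ≤ L := by omega
  refine le_energyBarrier fun τ hτ p => ?_
  rw [Set.mem_ofPred_eq, pottsH_constConfig hK3 hL3 h hm] at hτ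
  rw [pottsH_constConfig hK3 hL3 h hm]
  have hend : ℓ * (ℓ - 1) + 1 ≤ #(onesSet τ) := by
    by_contra! hlt
    have h2 := dropletEnergy_nonneg h0 h1 (by omega) hℓ hℓ' hK hL hlt.le
    have h3 := dropletEnergy_onesSet_le hK3 hL3 h τ
    linarith
  obtain ⟨i, hi⟩ := p.exists_eq (fun σ => #(onesSet σ))
    (fun _ _ hQ => card_onesSet_le_of_pottsQ_pos hq hQ)
    (by simp [onesSet_constConfig hm]) hend
  refine ⟨i, ?_⟩
  have h2 := le_dropletEnergy_of_card_eq (h := h) (by omega) hK hL hi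
  have h3 := dropletEnergy_onesSet_le hK3 hL3 h (p.ω i)
  linarith

end States

lemma two_lt_mul_criticalLength {h : ℝ} (h0 : 0 < h) (hint : ∀ n : ℤ, 2 / h ≠ (n : ℝ)) :
    2 < h * criticalLength h := by
  have h1 : 2 / h < criticalLength h :=
    lt_of_le_of_ne (Nat.le_ceil _) (by exact_mod_cast hint (criticalLength h : ℤ))
  rwa [div_lt_iff₀' h0] at h1

lemma mul_criticalLength_sub_one_lt {h : ℝ} (h0 : 0 < h) : h * (criticalLength h - 1) < 2 := by
  have h1 : (criticalLength h : ℝ) < 2 / h + 1 := Nat.ceil_lt_add_one (by positivity)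
  have h2 : (criticalLength h : ℝ) - 1 < 2 / h := by linarith
  rwa [lt_div_iff₀' h0] at h2

lemma three_le_criticalLength {h : ℝ} (h0 : 0 < h) (h1 : h < 1) : 3 ≤ criticalLength h := by
  have h2 : (2 : ℕ) < criticalLength h := by
    rw [criticalLength, Nat.lt_ceil, lt_div_iff₀ h0]
    push_cast
    linarith
  omega

theorem mainTheorem2 (q K L : ℕ) (h : ℝ) (hq : 2 < q) (h0 : 0 < h) (h1 : h < 1)
    (hint : ∀ n : ℤ, 2 / h ≠ (n : ℝ))
    (hK : 3 * criticalLength h ≤ K) (hL : 3 * criticalLength h ≤ L) :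
    stableSet (pottsH q K L h) = {σ | ∃ m : PottsSpin q, (m : ℕ) = 1 ∧ σ = constConfig K L m} ∧
    metastableSet (pottsH q K L h) (pottsQ q K L) =
      {σ | ∃ m : PottsSpin q, 2 ≤ (m : ℕ) ∧ σ = constConfig K L m} ∧
    ∀ η ∈ metastableSet (pottsH q K L h) (pottsQ q K L),
      stabilityLevel (pottsH q K L h) (pottsQ q K L) η =
          energyBarrier (pottsH q K L h) (pottsQ q K L) η (stableSet (pottsH q K L h)) ∧
      energyBarrier (pottsH q K L h) (pottsQ q K L) η (stableSet (pottsH q K L h)) =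
        ((4 * (criticalLength h : ℝ) -
          h * ((criticalLength h : ℝ) * ((criticalLength h : ℝ) - 1) + 1) : ℝ) : EReal) := by
  have hℓ := two_lt_mul_criticalLength h0 hint
  have hℓ' := mul_criticalLength_sub_one_lt h0
  have hℓ3 := three_le_criticalLength h0 h1
  have hpos := rectEnergy_critical_pos h0 hℓ hℓ'
  have hΓ : 4 * (criticalLength h : ℝ) -
      h * ((criticalLength h : ℝ) * ((criticalLength h : ℝ) - 1) + 1) =
      rectEnergy h (criticalLength h) (criticalLength h - 1) + (2 - h) := by
    unfold rectEnergy
    ring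
  rw [hΓ]
  set ℓ := criticalLength h
  set Γ := rectEnergy h ℓ (ℓ - 1) + (2 - h)
  set H := pottsH q K L h
  set Q := pottsQ q K L
  have hΓpos : 0 < Γ := by linarith
  have hK3 : 3 ≤ K := by omega
  have hL3 : 3 ≤ L := by omega
  have : NeZero K := ⟨by omega⟩
  have : NeZero L := ⟨by omega⟩
  obtain ⟨s, hs⟩ : ∃ s : PottsSpin q, (s : ℕ) = 1 :=
    ⟨⟨1, Finset.mem_Icc.2 ⟨le_rfl, by omega⟩⟩, rfl⟩
  obtain ⟨t, ht⟩ : ∃ t : PottsSpin q, (t : ℕ) = 2 :=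
    ⟨⟨2, Finset.mem_Icc.2 ⟨by norm_num, hq.le⟩⟩, rfl⟩
  have hstable : stableSet H = {constConfig K L s} := stableSet_pottsH hK3 hL3 h0 hs
  have hdesc : ∀ σ, σ ∉ stableSet H →
      ∃ η, H η < H σ ∧ Reaches Q (fun ρ => H ρ ≤ H σ + Γ) σ η := by
    intro σ hσ
    rw [hstable, Set.mem_singleton_iff, eq_constConfig_one_iff hs, not_forall] at hσ
    obtain ⟨u, hu⟩ := hσ
    exact exists_descent_le (by omega) h0 (by linarith) hℓ3 hℓ hℓ' hK hL hs σ hu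
  have hle : ∀ σ, σ ∉ stableSet H → stabilityLevel H Q σ ≤ (Γ : EReal) := by
    intro σ hσ
    obtain ⟨η, hη, hr⟩ := hdesc σ hσ
    exact energyBarrier_le_of_reaches hΓpos.le hη hr
  have hlt : ∀ σ, (∀ m, σ ≠ constConfig K L m) → stabilityLevel H Q σ < (Γ : EReal) := by
    intro σ hσ
    obtain ⟨u, w, hedge, hne⟩ := exists_edge_ne σ hσ
    obtain ⟨η, hη, hr⟩ :=
      exists_descent_lt (by omega) h0 (by linarith) hℓ3 hℓ hℓ' hK hL hs σ hedge hne
    exact energyBarrier_lt_of_reaches hΓpos hη hr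
  have hne : ∀ m : PottsSpin q, 2 ≤ (m : ℕ) → constConfig K L m ∉ stableSet H := by
    intro m hm hmem
    rw [hstable, Set.mem_singleton_iff, eq_constConfig_one_iff hs, onesSet_constConfig hm] at hmem
    simpa using hmem (0, 0)
  have hge : ∀ m : PottsSpin q, 2 ≤ (m : ℕ) →
      (Γ : EReal) ≤ stabilityLevel H Q (constConfig K L m) := fun m hm =>
    le_stabilityLevel_constConfig (by omega) h0 h1 hℓ3 hℓ hℓ' hK hL hm
  have hmax : maxStabilityLevel H Q = (Γ : EReal) :=
    le_antisymm (iSup₂_le hle)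
      ((hge t ht.ge).trans (le_iSup₂ (f := fun σ (_ : σ ∈ (stableSet H)ᶜ) =>
        stabilityLevel H Q σ) _ (hne t ht.ge)))
  have hmeta : metastableSet H Q =
      {σ | ∃ m : PottsSpin q, 2 ≤ (m : ℕ) ∧ σ = constConfig K L m} := by
    ext σ
    rw [metastableSet, Set.mem_ofPred_eq, Set.mem_ofPred_eq, hmax]
    constructor
    · intro hσ
      by_contra hnot
      by_cases hconst : ∃ m, σ = constConfig K L m
      · obtain ⟨m, rfl⟩ := hconst
        have hm1 : (m : ℕ) = 1 := by
          by_contra hm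
          have := (Finset.mem_Icc.1 m.2).1
          exact hnot ⟨m, by omega, rfl⟩
        have hms : m = s := Subtype.ext (hm1.trans hs.symm)
        rw [stabilityLevel_of_mem_stableSet (by rw [hstable, hms]; rfl)] at hσ
        exact EReal.coe_ne_top _ hσ.symm
      · push Not at hconst
        exact (hlt σ hconst).ne hσ
    · rintro ⟨m, hm, rfl⟩
      exact le_antisymm (hle _ (hne m hm)) (hge m hm)
  refine ⟨?_, hmeta, ?_⟩
  · rw [hstable]
    ext σ
    constructor
    · rintro rfl
      exact ⟨s, hs, rfl⟩
    · rintro ⟨m, hm, rfl⟩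
      rw [Subtype.ext (hm.trans hs.symm)]
      rfl
  · intro η hη
    rw [hmeta] at hη
    obtain ⟨m, hm, rfl⟩ := hη
    have hup : energyBarrier H Q (constConfig K L m) (stableSet H) ≤ (Γ : EReal) := by
      obtain ⟨ρ, hρ, hr⟩ := exists_reaches_stableSet hdesc (constConfig K L m)
      exact energyBarrier_le_of_reaches hΓpos.le hρ hr
    have hmono : stabilityLevel H Q (constConfig K L m) ≤
        energyBarrier H Q (constConfig K L m) (stableSet H) := by
      refine energyBarrier_anti _ fun ρ hρ => ?_
      refine show H ρ < H _ from lt_of_not_ge fun hge' => hne m hm fun τ => ?_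
      exact hge'.trans (hρ τ)
    exact ⟨le_antisymm hmono (hup.trans (hge m hm)), le_antisymm hup ((hge m hm).trans hmono)⟩
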